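/- **Setting.** Packets $j=1,2,\dots$ of random lengths $L_j\in(0,L_{\max}]$ start arriving at random times $0\le s_1<s_2<\cdots\to\infty$ on a link of capacity $C$, with $s_j+L_j/C<s_{j+1}$. For starting times $x=(x_j)$, the packet stream with starting times $x$ is the function $R$ with $R(t)=C$ if $t\in[x_j,x_j+L_j/C)$ for some $j$, and $R(t)=0$ otherwise. The input stream $R_{\rm i}$ is the packet stream with starting times $(s_j)$; assume that the process $(R_{\rm i}(t))_{t\ge0}$ is stationary and ergodic. Let $0<\rho<C$, $\delta=(1-\rho/C)L_{\max}$, and for a stream $R$ let $$W_\rho(t;R)=\max_{0\le s\le t}\Big[\int_s^tR(\tau)\,d\tau-\rho(t-s)\Big],\qquad o_\zeta(t;R)=\frac1t\,\big|\{\tau\in[0,t]:W_\rho(\tau;R)\ge\zeta\}\big| .$$ Assume that $\rho$ is at least the long-term average rate $\lim_{t\to\infty}\frac1{t-s}\int_s^tR_{\rm i}(\tau)\,d\tau$ $(s\ge 0)$ and, if it equals that rate, that almost surely $\sup_{t\ge 0} W_\rho(t;R_{\rm i})<\infty$. **Bounding function.** Let $M\ge2$, $T_1<\dots<T_M$ and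 $T$ satisfy $T_1\ge\delta$, $T_{i+1}-T_i\ge\delta$ $(1\le i\le M-1)$, $T-T_{M-1}\ge\delta$, $T_M>T$, and put $\sigma_i=T_i-\delta$. Let $f>0$ be non-increasing on $[0,T]$ with $f(0)=1$, differentiable at $T_2,\dots,T_{M-1}$, and not constant on any of the intervals $(T_i,T_{i+1}]$ $(1\le i\le M-2)$ and $(T_{M-1},T]$. The piecewise-linear approximation $\bar f$ is one of the following two functions. Both equal $1$ on $[0,T_1)$, $f(T)$ on $[T_{M-1},T_M]$ and $0$ beyond $T_M$. For $1\le i\le M-2$, on $[T_i,T_{i+1})$: (a) $\bar f(\gamma)=f(T_{i+1})+m_i(\gamma-T_{i+1})$, where $m_i$ is the slope of the chord of $f$ over $[T_i,T_{i+1}]$ if $f$ is at least this chord on $[T_i,T_{i+1})$, and $m_i=f'(T_{i+1})$ otherwise; or (b) $\bar f=f(\sigma_{i+1})$ on $[T_i,\sigma_{i+1})$, and on $[\sigma_{i+1},T_{i+1})$ $\bar f$ is given as in (a), with the interval $[\sigma_{i+1},T_{i+1})$ in place of $[T_i,T_{i+1})$. Assume that $\bar f\le f$ on $[T_1,T]$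 (this holds, for instance, if $f$ is convex). **Regulator.** The basic $(\sigma^*,\rho)$ regulator assigns departure times $t_j$ recursively; packet $j$ leaves completely at $b_j=t_j+L_j/C$. Put $\tilde s_1=s_1$ and $\tilde s_j=\max\{s_j,b_{j-1}\}$ for $j\geq 2$; let $R_1$ and $R_{\rm o}$ be the packet streams with starting times $(\tilde s_j)$ and $(t_j)$, and for $\sigma\in\{\sigma_1,\dots,\sigma_M\}$ let $$t_j(\sigma)=\tilde s_j+\max\{W_\rho(\tilde s_j;R_1)-\sigma,0\}/\rho,\qquad b_j(\sigma)=t_j(\sigma)+L_j/C .$$ Let $\mathcal B_j=\{1\le\ell\le M:\sigma_\ell\ge W_\rho(\tilde s_j;R_1)\}$; assume that $T_M$ is so large that almost surely $\mathcal B_j\neq\emptyset$ for all $j$. Let $$\mathcal I_j=\{2\le\ell\le\min\mathcal B_j:\ o_{T_{\ell-1}}(b_j(\sigma_\ell))\le\bar f(T_\ell)\},$$ where the overshoot ratio is that of the output stream in which packets $1,\dots,j-1$ depart at their times $t_1,\dots,t_{j-1}$ and packet $j$ departs at $t_j(\sigma_\ell)$. Then $t_j=t_j(\sigma^*(j))$,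 where $\sigma^*(j)=\sigma_{\max\mathcal I_j}$ if $\mathcal I_j\ne\emptyset$ and $\sigma^*(j)=\sigma_1$ otherwise. **Theorem.** Almost surely there is a (random) time $t_0$ such that the output stream satisfies $$o_\gamma(t;R_{\rm o})\le f(\gamma)\qquad\text{for all } t\ge t_0\text{ and all }\gamma\in[T_1,T].$$ -/

import Mathlib

open MeasureTheory ProbabilityTheory Set Filter Topology
open scoped NNReal

namespace StochReg

noncomputable section

/-! ### Traffic streams, virtual workload and overshoot ratio -/

/-- The traffic rate at time `t` of the packets with index in `J`, where packet `j` has length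
`L j` bits and is transmitted on a link of capacity `C` from time `x j` to time `x j + L j / C`. -/
def packetStream (C : ℝ) (L x : ℕ → ℝ) (J : Set ℕ) (t : ℝ) : ℝ :=
  (⋃ j ∈ J, Ico (x j) (x j + L j / C)).indicator (fun _ => C) t

/-- The virtual workload `W_ρ(t; R) = max_{0 ≤ s ≤ t} [∫_s^t R - ρ (t - s)]`. -/
def workload (ρ : ℝ) (R : ℝ → ℝ) (t : ℝ) : ℝ :=
  sSup ((fun s => (∫ τ in s..t, R τ) - ρ * (t - s)) '' Icc 0 t)

/-- The overshoot duration `O_ζ(t; R)`: the total length of the intervals of times in `[0, t]`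
during which the workload is at least `ζ`. -/
def overshootDuration (ρ : ℝ) (R : ℝ → ℝ) (ζ t : ℝ) : ℝ :=
  volume.real {τ | τ ∈ Icc 0 t ∧ ζ ≤ workload ρ R τ}

/-- The overshoot ratio `o_ζ(t) = O_ζ(t; R) / t`. -/
def overshootRatio (ρ : ℝ) (R : ℝ → ℝ) (ζ t : ℝ) : ℝ :=
  overshootDuration ρ R ζ t / t

/-- `r` is the long-term average rate of the traffic stream `R`. -/
def HasLongTermRate (R : ℝ → ℝ) (r : ℝ) : Prop :=
  ∀ s, 0 ≤ s → Tendsto (fun t => (∫ τ in s..t, R τ) / (t - s)) atTop (𝓝 r)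

/-! ### Piecewise-linear approximation of the bounding function -/

/-- The line through `(b, f b)` with slope `m`, evaluated at `γ`. -/
def lineThrough (f : ℝ → ℝ) (b m γ : ℝ) : ℝ := f b + m * (γ - b)

/-- Slope of the chord of `f` between `a` and `b`. -/
def chordSlope (f : ℝ → ℝ) (a b : ℝ) : ℝ := (f b - f a) / (b - a)

open Classical in
/-- Slope used on `[a, b)`: the chord slope if `f` lies above its chord on `[a, b)`, and the slope
of the tangent of `f` at `b` otherwise. -/
def pieceSlope (f : ℝ → ℝ) (a b : ℝ) : ℝ :=
  if ∀ γ ∈ Ico a b, lineThrough f b (chordSlope f a b) γ ≤ f γ then chordSlope f a b else deriv f b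

open Classical in
/-- Piecewise-linear function with breakpoints `T 1 < ... < T M` and limit `Tlim`: it is `1` on
`[0, T 1)`; on `[T i, T (i + 1))`, `1 ≤ i ≤ M - 2`, it is the constant `f (a i)` before `a i` and
linear from `a i` on; it is `f Tlim` on `[T (M - 1), T M]` and `0` beyond `T M`. -/
def piecewiseBound (f : ℝ → ℝ) (M : ℕ) (T : ℕ → ℝ) (Tlim : ℝ) (a : ℕ → ℝ) (γ : ℝ) : ℝ :=
  if γ < T 1 then 1
  else if γ < T (M - 1) then
    let i := Nat.findGreatest (fun i => T i ≤ γ) (M - 2)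
    if γ < a i then f (a i)
    else lineThrough f (T (i + 1)) (pieceSlope f (a i) (T (i + 1))) γ
  else if γ ≤ T M then f Tlim
  else 0

/-- The function `f̄`: linear on each `[T i, T (i + 1))`, `1 ≤ i ≤ M - 2`. -/
def fbar (f : ℝ → ℝ) (M : ℕ) (T : ℕ → ℝ) (Tlim : ℝ) : ℝ → ℝ :=
  piecewiseBound f M T Tlim T

/-- The modified function `f̄` (for breakpoints spaced by more than `δ`): with
`σ_{i+1} = T_{i+1} - δ`, it is the constant `f σ_{i+1}` on `[T i, σ_{i+1})` and linear on
`[σ_{i+1}, T_{i+1})`, `1 ≤ i ≤ M - 2`. -/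
def fbarModified (f : ℝ → ℝ) (M : ℕ) (T : ℕ → ℝ) (Tlim δ : ℝ) : ℝ → ℝ :=
  piecewiseBound f M T Tlim (fun i => T (i + 1) - δ)

/-! ### The basic `(σ*, ρ)` regulator

Packets are numbered from `0`. -/

/-- Parameters of the regulator: link capacity, rate, maximal packet length, number of burst sizes,
thresholds `T 1, ..., T M`, and the function `f̄` against which overshoot ratios are checked. -/
structure Params where
  C : ℝ
  ρ : ℝ
  Lmax : ℝ
  M : ℕ
  T : ℕ → ℝ
  bound : ℝ → ℝ

namespace Params

variable (p : Params)

/-- `δ = (1 - ρ / C) L_max`. -/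
def δ : ℝ := (1 - p.ρ / p.C) * p.Lmax

/-- `σ_i = T_i - δ`. -/
def σ (i : ℕ) : ℝ := p.T i - p.δ

end Params

/-- The time `s̃_j = max (s_j, b_{j-1})` at which packet `j` leaves the front-end buffer, given the
arrival times `s`, the lengths `L` and the departure times `t` of the packets. -/
def serverArrival (p : Params) (s L t : ℕ → ℝ) : ℕ → ℝ
  | 0 => s 0
  | j + 1 => max (s (j + 1)) (t j + L j / p.C)

/-- `W_ρ(s̃_j; R_1)`; only packets before packet `j` contribute to `R_1` before time `s̃_j`. -/
def serverWorkload (p : Params) (s L t : ℕ → ℝ) (j : ℕ) : ℝ :=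
  workload p.ρ (packetStream p.C L (serverArrival p s L t) (Iio j)) (serverArrival p s L t j)

/-- `t_j(σ) = [W_ρ(s̃_j; R_1) - σ]^+ / ρ + s̃_j`. -/
def candDeparture (p : Params) (s L t : ℕ → ℝ) (j : ℕ) (σ : ℝ) : ℝ :=
  max (serverWorkload p s L t j - σ) 0 / p.ρ + serverArrival p s L t j

/-- `b_j(σ) = t_j(σ) + L_j / C`. -/
def candFinish (p : Params) (s L t : ℕ → ℝ) (j : ℕ) (σ : ℝ) : ℝ :=
  candDeparture p s L t j σ + L j / p.C

/-- The output stream up to packet `j` that results if packet `j` departs at time `t_j(σ)`. -/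
def candOutput (p : Params) (s L t : ℕ → ℝ) (j : ℕ) (σ : ℝ) : ℝ → ℝ :=
  packetStream p.C L (Function.update t j (candDeparture p s L t j σ)) (Iic j)

/-- `𝓑_j = {1 ≤ ℓ ≤ M : σ_ℓ ≥ W_ρ(s̃_j; R_1)}`. -/
def setB (p : Params) (s L t : ℕ → ℝ) (j : ℕ) : Set ℕ :=
  {ℓ | 1 ≤ ℓ ∧ ℓ ≤ p.M ∧ serverWorkload p s L t j ≤ p.σ ℓ}

/-- `𝓘_j = {2 ≤ ℓ ≤ min 𝓑_j : o_{T_{ℓ-1}}(b_j(σ_ℓ)) ≤ f̄(T_ℓ)}`. -/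
def setI (p : Params) (s L t : ℕ → ℝ) (j : ℕ) : Set ℕ :=
  {ℓ | 2 ≤ ℓ ∧ ℓ ≤ sInf (setB p s L t j) ∧
    overshootRatio p.ρ (candOutput p s L t j (p.σ ℓ)) (p.T (ℓ - 1))
      (candFinish p s L t j (p.σ ℓ)) ≤ p.bound (p.T ℓ)}

open Classical in
/-- `σ*(j) = σ_{max 𝓘_j}` if `𝓘_j` is non-empty, and `σ_1` otherwise. -/
def burst (p : Params) (s L t : ℕ → ℝ) (j : ℕ) : ℝ :=
  if (setI p s L t j).Nonempty then p.σ (sSup (setI p s L t j)) else p.σ 1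

/-- The departure times `t_j = t_j(σ*(j))` of the packets from the regulator. The decision about
packet `j` uses the departure times of the earlier packets only. -/
def departure (p : Params) (s L : ℕ → ℝ) (j : ℕ) : ℝ :=
  let past : ℕ → ℝ := fun i => if i < j then departure p s L i else 0
  candDeparture p s L past j (burst p s L past j)
termination_by j

/-- The input stream `R_i`. -/
def inputStream (p : Params) (s L : ℕ → ℝ) : ℝ → ℝ := packetStream p.C L s univ

/-- The output stream `R_o`. -/
def outputStream (p : Params) (s L : ℕ → ℝ) : ℝ → ℝ :=
  packetStream p.C L (departure p s L) univ

/-! Consistency: the recursion says `t_j = t_j(σ*(j))` for the actual departure times. -/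

theorem serverArrival_congr (p : Params) (s L : ℕ → ℝ) {t t' : ℕ → ℝ} {j : ℕ}
    (h : ∀ i < j, t i = t' i) {i : ℕ} (hi : i ≤ j) :
    serverArrival p s L t i = serverArrival p s L t' i := by
  cases i with
  | zero => rfl
  | succ i => simp only [serverArrival, h i hi]

theorem packetStream_congr (C : ℝ) (L : ℕ → ℝ) {x y : ℕ → ℝ} {J : Set ℕ}
    (h : ∀ i ∈ J, x i = y i) : packetStream C L x J = packetStream C L y J := by
  have : (⋃ j ∈ J, Ico (x j) (x j + L j / C)) = ⋃ j ∈ J, Ico (y j) (y j + L j / C) :=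
    iUnion₂_congr fun i hi => by rw [h i hi]
  funext t
  simp only [packetStream, this]

theorem serverWorkload_congr (p : Params) (s L : ℕ → ℝ) {t t' : ℕ → ℝ} {j : ℕ}
    (h : ∀ i < j, t i = t' i) : serverWorkload p s L t j = serverWorkload p s L t' j := by
  unfold serverWorkload
  have hR : packetStream p.C L (serverArrival p s L t) (Iio j) =
      packetStream p.C L (serverArrival p s L t') (Iio j) :=
    packetStream_congr p.C L fun i hi => serverArrival_congr p s L h (le_of_lt hi)
  rw [serverArrival_congr p s L h le_rfl, hR]

theorem candDeparture_congr (p : Params) (s L : ℕ → ℝ) {t t' : ℕ → ℝ} {j : ℕ}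
    (h : ∀ i < j, t i = t' i) : candDeparture p s L t j = candDeparture p s L t' j := by
  funext σ
  unfold candDeparture
  rw [serverArrival_congr p s L h le_rfl, serverWorkload_congr p s L h]

theorem burst_congr (p : Params) (s L : ℕ → ℝ) {t t' : ℕ → ℝ} {j : ℕ}
    (h : ∀ i < j, t i = t' i) : burst p s L t j = burst p s L t' j := by
  have hB : setB p s L t j = setB p s L t' j := by
    unfold setB; rw [serverWorkload_congr p s L h]
  have hO : ∀ σ, candOutput p s L t j σ = candOutput p s L t' j σ := by
    intro σ
    unfold candOutput
    rw [candDeparture_congr p s L h]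
    refine packetStream_congr p.C L fun i (hi : i ≤ j) => ?_
    rcases hi.lt_or_eq with hlt | rfl
    · rw [Function.update_of_ne hlt.ne, Function.update_of_ne hlt.ne, h i hlt]
    · simp
  have hI : setI p s L t j = setI p s L t' j := by
    unfold setI candFinish
    simp only [hB, hO, candDeparture_congr p s L h]
  unfold burst
  rw [hI]

theorem departure_eq (p : Params) (s L : ℕ → ℝ) (j : ℕ) :
    departure p s L j =
      candDeparture p s L (departure p s L) j (burst p s L (departure p s L) j) := by
  have h : ∀ i < j, (fun i => if i < j then departure p s L i else 0) i = departure p s L i := by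
    intro i hi
    simp [hi]
  rw [departure]
  rw [candDeparture_congr p s L h, burst_congr p s L h]

/-! ### Stationary and ergodic processes -/

variable {Ω : Type*} [MeasurableSpace Ω]

/-- The process `X` is stationary: its law on path space is invariant under time shifts. -/
def IsStationary (P : Measure Ω) (X : ℝ≥0 → Ω → ℝ) : Prop :=
  ∀ u : ℝ≥0, IdentDistrib (fun ω (t : ℝ≥0) => X (t + u) ω) (fun ω (t : ℝ≥0) => X t ω) P P

/-- The process `X` is ergodic: every event of path space that is invariant under all time shifts
up to null sets has probability `0` or `1`. -/
def IsErgodic (P : Measure Ω) (X : ℝ≥0 → Ω → ℝ) : Prop :=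
  ∀ A : Set (ℝ≥0 → ℝ), MeasurableSet A →
    (∀ u : ℝ≥0, ∀ᵐ ω ∂P, (fun t : ℝ≥0 => X (t + u) ω) ∈ A ↔ (fun t : ℝ≥0 => X t ω) ∈ A) →
    (∀ᵐ ω ∂P, (fun t : ℝ≥0 => X t ω) ∈ A) ∨ (∀ᵐ ω ∂P, (fun t : ℝ≥0 => X t ω) ∉ A)

end

end StochReg

namespace StochReg

/-! The argument has a deterministic half, about one sequence of packets, and a probabilistic half,
about the input.

Deterministic half. Packet `j` waits until the output workload has drained to its burst size, and
sending it adds at most `δ`. Since `σ l + δ = T l` and `T i ≤ σ (i + 1)`, a packet that carries the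
workload across `T i` must have been admitted with index exactly `i + 1`. It therefore passed the
overshoot test, so at its completion the overshoot ratio of `T i` is at most `β = f̄ (T (i + 1))`
(`overshootRatio_le_of_lift`). If long excursions above `T 1` take a negligible fraction of time,
then such a crossing occurred shortly before any late time spent above `T i`. Hence the overshoot
duration of `T i` is eventually at most `(β + η) t` for every `η > 0`
(`eventually_overshootDuration_le`).

The error `η` is removed by strictness of `f`. For a level `γ > T i`, each climb from `T i` to `γ`
takes a minimal time because the workload has slope at most `C - ρ`. So the time spent in `[T i, γ)`
is a definite share of the time above `γ`, up to long excursions, and the duration of `γ` drops to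
`β t` (`eventually_overshootDuration_le_of_lt`). An intermediate level `γ₀` with `f γ₀ > f e`, where
`e` is the right end of the interval, then splits `[T i, e]`: below `γ₀` there is room for `η`,
above it the sharper bound applies (`eventually_overshootRatio_le_on`).

Probabilistic half. The regulator only delays bits, so the output workload is at most the input
workload (`workload_output_le`), and it suffices that long excursions of the input workload are rare
(`ae_rareLongExcursions`). Both cases rest on the maximal ergodic theorem: visits to events
shrinking to a null set become uniformly rare along almost every orbit. If the mean rate is below
`ρ`, a long excursion forces a fixed fraction of the times in it to be followed by a large net input
at a reduced service rate `ρ'`. If the mean rate equals `ρ`, net inputs are bounded; while the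
workload is high, the future net input stays away from its supremum, and by recurrence that cannot
last. -/

/-- A measurable traffic rate with values in `[0, C]`. -/
structure IsTraffic (C : ℝ) (R : ℝ → ℝ) : Prop where
  measurable : Measurable R
  nonneg : ∀ t, 0 ≤ R t
  le : ∀ t, R t ≤ C

/-! ### Elementary dynamics of the virtual workload -/

namespace IsTraffic

variable {C ρ : ℝ} {R : ℝ → ℝ}

theorem intervalIntegrable (h : IsTraffic C R) (a b : ℝ) : IntervalIntegrable R volume a b := by
  refine (intervalIntegrable_const (c := C)).mono_fun h.measurable.aestronglyMeasurable ?_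
  refine Eventually.of_forall fun t => ?_
  dsimp only
  rw [Real.norm_of_nonneg (h.nonneg t), Real.norm_of_nonneg ((h.nonneg t).trans (h.le t))]
  exact h.le t

theorem integral_nonneg (h : IsTraffic C R) {a b : ℝ} (hab : a ≤ b) : 0 ≤ ∫ τ in a..b, R τ :=
  intervalIntegral.integral_nonneg hab fun t _ => h.nonneg t

theorem integral_le (h : IsTraffic C R) {a b : ℝ} (hab : a ≤ b) :
    ∫ τ in a..b, R τ ≤ C * (b - a) := by
  have := intervalIntegral.integral_mono_on hab (h.intervalIntegrable a b)
    (intervalIntegrable_const (c := C)) fun t _ => h.le t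
  simpa [mul_comm] using this

theorem integral_add (h : IsTraffic C R) (a b c : ℝ) :
    (∫ τ in a..b, R τ) + ∫ τ in b..c, R τ = ∫ τ in a..c, R τ :=
  intervalIntegral.integral_add_adjacent_intervals (h.intervalIntegrable a b)
    (h.intervalIntegrable b c)

theorem continuous_integral (h : IsTraffic C R) (t : ℝ) :
    Continuous fun s => ∫ τ in s..t, R τ := by
  have h1 : Continuous fun s => ∫ τ in t..s, R τ :=
    intervalIntegral.continuous_primitive (fun a b => h.intervalIntegrable a b) t
  have : (fun s => ∫ τ in s..t, R τ) = fun s => -∫ τ in t..s, R τ := by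
    funext s; rw [intervalIntegral.integral_symm]
  rw [this]; exact h1.neg

theorem exists_workload_eq (h : IsTraffic C R) {t : ℝ} (ht : 0 ≤ t) :
    ∃ s ∈ Icc 0 t, workload ρ R t = (∫ τ in s..t, R τ) - ρ * (t - s) := by
  have hc : ContinuousOn (fun s => (∫ τ in s..t, R τ) - ρ * (t - s)) (Icc 0 t) :=
    ((h.continuous_integral t).sub (by fun_prop)).continuousOn
  obtain ⟨s, hs, hs1, -⟩ := isCompact_Icc.exists_sSup_image_eq_and_ge (nonempty_Icc.2 ht) hc
  exact ⟨s, hs, hs1⟩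

theorem le_workload (h : IsTraffic C R) {s t : ℝ} (hs : 0 ≤ s) (hst : s ≤ t) :
    (∫ τ in s..t, R τ) - ρ * (t - s) ≤ workload ρ R t := by
  have hc : ContinuousOn (fun s => (∫ τ in s..t, R τ) - ρ * (t - s)) (Icc 0 t) :=
    ((h.continuous_integral t).sub (by fun_prop)).continuousOn
  exact le_csSup (isCompact_Icc.image_of_continuousOn hc).bddAbove
    (mem_image_of_mem (fun s => (∫ τ in s..t, R τ) - ρ * (t - s)) ⟨hs, hst⟩)

theorem workload_nonneg (h : IsTraffic C R) {t : ℝ} (ht : 0 ≤ t) : 0 ≤ workload ρ R t := by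
  simpa using h.le_workload (ρ := ρ) ht le_rfl

theorem workload_zero (h : IsTraffic C R) : workload ρ R 0 = 0 := by
  obtain ⟨s, hs, hw⟩ := h.exists_workload_eq (ρ := ρ) (le_refl (0 : ℝ))
  have : s = 0 := le_antisymm hs.2 hs.1
  simp [hw, this]

theorem workload_add_le (h : IsTraffic C R) {a b : ℝ} (ha : 0 ≤ a) (hab : a ≤ b) :
    workload ρ R a + ((∫ τ in a..b, R τ) - ρ * (b - a)) ≤ workload ρ R b := by
  obtain ⟨s, hs, hw⟩ := h.exists_workload_eq (ρ := ρ) ha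
  have := h.le_workload (ρ := ρ) hs.1 (hs.2.trans hab)
  have h2 := h.integral_add s a b
  rw [hw]; linarith

theorem workload_sub_le (h : IsTraffic C R) {a b : ℝ} (ha : 0 ≤ a) (hab : a ≤ b) :
    workload ρ R a - ρ * (b - a) ≤ workload ρ R b := by
  have := h.workload_add_le (ρ := ρ) ha hab
  have := h.integral_nonneg hab
  linarith

/-- Either the workload at `b` evolved from the one at `a` without hitting zero, or it is generated
by traffic after `a`. -/
theorem workload_eq_or (h : IsTraffic C R) {a b : ℝ} (ha : 0 ≤ a) (hab : a ≤ b) :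
    workload ρ R b = workload ρ R a + ((∫ τ in a..b, R τ) - ρ * (b - a)) ∨
      ∃ s ∈ Icc a b, workload ρ R b = (∫ τ in s..b, R τ) - ρ * (b - s) := by
  obtain ⟨s, hs, hw⟩ := h.exists_workload_eq (ρ := ρ) (ha.trans hab)
  rcases le_total s a with hsa | hsa
  · left
    refine le_antisymm ?_ (h.workload_add_le ha hab)
    have := h.le_workload (ρ := ρ) hs.1 hsa
    have h2 := h.integral_add s a b
    rw [hw]; linarith
  · exact Or.inr ⟨s, ⟨hsa, hs.2⟩, hw⟩

theorem workload_le_add (h : IsTraffic C R) (hC : ρ ≤ C) {a b : ℝ} (ha : 0 ≤ a) (hab : a ≤ b) :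
    workload ρ R b ≤ workload ρ R a + (C - ρ) * (b - a) := by
  rcases h.workload_eq_or (ρ := ρ) ha hab with hw | ⟨s, hs, hw⟩
  · have := h.integral_le hab
    rw [hw]; linarith
  · have := h.integral_le hs.2
    have h0 := h.workload_nonneg (ρ := ρ) ha
    have : (C - ρ) * (b - s) ≤ (C - ρ) * (b - a) :=
      mul_le_mul_of_nonneg_left (by linarith [hs.1]) (by linarith)
    rw [hw]; linarith

/-- The workload changes with slope between `-ρ` and `C - ρ`, and `C` dominates both in absolute
value. -/
theorem continuousOn_workload (h : IsTraffic C R) (hρ : 0 ≤ ρ) (hC : ρ ≤ C) :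
    ContinuousOn (workload ρ R) (Ici 0) := by
  have : LipschitzOnWith (Real.toNNReal C) (workload ρ R) (Ici 0) := by
    have key : ∀ x ∈ Ici (0 : ℝ), ∀ y ∈ Ici (0 : ℝ), x ≤ y →
        |workload ρ R x - workload ρ R y| ≤ C * |x - y| := by
      intro x hx y hy hxy
      have h1 := h.workload_le_add hC hx hxy
      have h2 := h.workload_sub_le (ρ := ρ) hx hxy
      rw [abs_sub_comm x y, abs_of_nonneg (sub_nonneg.2 hxy), abs_le]
      have : 0 ≤ y - x := sub_nonneg.2 hxy
      constructor <;> nlinarith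
    refine LipschitzOnWith.of_dist_le_mul fun x hx y hy => ?_
    rw [Real.dist_eq, Real.dist_eq, Real.coe_toNNReal _ (hρ.trans hC)]
    rcases le_total x y with hxy | hxy
    · exact key x hx y hy hxy
    · rw [abs_sub_comm, abs_sub_comm x y]; exact key y hy x hx hxy
  exact this.continuousOn

theorem integral_eq_of_eq (c : ℝ) {a b : ℝ} (hab : a ≤ b)
    (hR : ∀ t ∈ Ico a b, R t = c) : ∫ τ in a..b, R τ = c * (b - a) := by
  have : ∫ τ in a..b, R τ = ∫ _ in a..b, c := by
    refine intervalIntegral.integral_congr_ae ?_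
    have hb : ∀ᵐ x : ℝ, x ≠ b := by simp [ae_iff, measure_singleton]
    filter_upwards [hb] with x hxb hx
    rw [uIoc_of_le hab] at hx
    exact hR x ⟨hx.1.le, lt_of_le_of_ne hx.2 hxb⟩
  rw [this]; simp [mul_comm]

/-- While the source transmits at full rate, the workload grows with slope `C - ρ`. -/
theorem workload_of_busy (h : IsTraffic C R) (hC : ρ ≤ C) {a b : ℝ} (ha : 0 ≤ a) (hab : a ≤ b)
    (hR : ∀ t ∈ Ico a b, R t = C) :
    workload ρ R b = workload ρ R a + (C - ρ) * (b - a) := by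
  refine le_antisymm (h.workload_le_add hC ha hab) ?_
  have := h.workload_add_le (ρ := ρ) ha hab
  rw [integral_eq_of_eq C hab hR] at this
  linarith

/-- While the source is silent, the workload drains at rate `ρ`. -/
theorem workload_of_idle (h : IsTraffic C R) (hρ : 0 ≤ ρ) {a b : ℝ} (ha : 0 ≤ a) (hab : a ≤ b)
    (hR : ∀ t ∈ Ico a b, R t = 0) :
    workload ρ R b = max (workload ρ R a - ρ * (b - a)) 0 := by
  refine le_antisymm ?_ (max_le (h.workload_sub_le ha hab) (h.workload_nonneg (ha.trans hab)))
  rcases h.workload_eq_or (ρ := ρ) ha hab with hw | ⟨s, hs, hw⟩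
  · rw [integral_eq_of_eq 0 hab hR] at hw
    rw [hw]; exact le_max_of_le_left (by linarith)
  · rw [integral_eq_of_eq 0 hs.2 fun t ht => hR t ⟨hs.1.trans ht.1, ht.2⟩] at hw
    rw [hw]
    refine le_max_of_le_right ?_
    nlinarith [hs.2]

end IsTraffic

theorem workload_congr {ρ : ℝ} {R R' : ℝ → ℝ} {t : ℝ} (h : ∀ τ ∈ Ico 0 t, R τ = R' τ) :
    workload ρ R t = workload ρ R' t := by
  unfold workload
  congr 1
  refine image_congr fun s hs => ?_
  have : ∫ τ in s..t, R τ = ∫ τ in s..t, R' τ := by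
    refine intervalIntegral.integral_congr_ae ?_
    have hb : ∀ᵐ x : ℝ, x ≠ t := by simp [ae_iff, measure_singleton]
    filter_upwards [hb] with x hxb hx
    rw [uIoc_of_le hs.2] at hx
    exact h x ⟨hs.1.trans hx.1.le, lt_of_le_of_ne hx.2 hxb⟩
  simp only [this]

/-! ### Packet streams -/

theorem isTraffic_packetStream {C : ℝ} (hC : 0 ≤ C) (L x : ℕ → ℝ) (J : Set ℕ) :
    IsTraffic C (packetStream C L x J) where
  measurable := by
    unfold packetStream
    exact measurable_const.indicator (MeasurableSet.biUnion (to_countable J)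
      fun j _ => measurableSet_Ico)
  nonneg t := indicator_nonneg (fun _ _ => hC) t
  le t := indicator_le_self' (f := fun _ => C) (fun _ _ => hC) t

theorem packetStream_of_mem {C : ℝ} {L x : ℕ → ℝ} {J : Set ℕ} {t : ℝ} {j : ℕ} (hj : j ∈ J)
    (ht : t ∈ Ico (x j) (x j + L j / C)) : packetStream C L x J t = C :=
  indicator_of_mem (mem_biUnion hj ht) _

theorem packetStream_of_forall_notMem {C : ℝ} {L x : ℕ → ℝ} {J : Set ℕ} {t : ℝ}
    (ht : ∀ j ∈ J, t ∉ Ico (x j) (x j + L j / C)) : packetStream C L x J t = 0 := by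
  refine indicator_of_notMem (fun hmem => ?_) _
  obtain ⟨j, hj, htj⟩ := mem_iUnion₂.1 hmem
  exact ht j hj htj

/-- `x` are starting times at which packets of lengths `L` can be sent one after the other. -/
structure IsSchedule (C : ℝ) (L x : ℕ → ℝ) : Prop where
  zero_le : 0 ≤ x 0
  pos : ∀ j, 0 < L j / C
  le_succ : ∀ j, x j + L j / C ≤ x (j + 1)

namespace IsSchedule

variable {C : ℝ} {L x : ℕ → ℝ}

theorem strictMono (h : IsSchedule C L x) : StrictMono x :=
  strictMono_nat_of_lt_succ fun j => by linarith [h.pos j, h.le_succ j]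

theorem nonneg (h : IsSchedule C L x) (j : ℕ) : 0 ≤ x j :=
  h.zero_le.trans (h.strictMono.monotone (Nat.zero_le j))

theorem finish_le (h : IsSchedule C L x) {i j : ℕ} (hij : i < j) : x i + L i / C ≤ x j :=
  (h.le_succ i).trans (h.strictMono.monotone hij)

theorem packetStream_gap (h : IsSchedule C L x) (J : Set ℕ) {j : ℕ} {t : ℝ}
    (ht : t ∈ Ico (x j + L j / C) (x (j + 1))) : packetStream C L x J t = 0 := by
  refine packetStream_of_forall_notMem fun i _ hi => ?_
  rcases lt_trichotomy i j with hij | rfl | hij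
  · linarith [hi.2, h.finish_le hij, ht.1, h.pos j]
  · exact absurd hi.2 (not_lt.2 ht.1)
  · linarith [hi.1, h.strictMono.monotone (Nat.succ_le_of_lt hij), ht.2]

theorem packetStream_before (h : IsSchedule C L x) (J : Set ℕ) {t : ℝ} (ht : t < x 0) :
    packetStream C L x J t = 0 := by
  refine packetStream_of_forall_notMem fun i _ hi => ?_
  linarith [hi.1, h.strictMono.monotone (Nat.zero_le i)]

/-- Before the start of packet `j`, only the packets before packet `j` matter. -/
theorem packetStream_eq_of_lt (h : IsSchedule C L x) {j : ℕ} {J J' : Set ℕ}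
    (hJ : ∀ i < j, i ∈ J ↔ i ∈ J') {t : ℝ} (ht : t < x j) :
    packetStream C L x J t = packetStream C L x J' t := by
  have aux : ∀ i, t ∈ Ico (x i) (x i + L i / C) → (i ∈ J ↔ i ∈ J') := fun i hi =>
    hJ i (h.strictMono.lt_iff_lt.1 (hi.1.trans_lt ht))
  unfold packetStream indicator
  congr 1
  simp only [mem_iUnion, eq_iff_iff]
  constructor
  · rintro ⟨i, hi, hti⟩; exact ⟨i, (aux i hti).1 hi, hti⟩
  · rintro ⟨i, hi, hti⟩; exact ⟨i, (aux i hti).2 hi, hti⟩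

/-- Every time is before the first packet, within a packet, or between two packets. -/
theorem exists_location (hx : Tendsto x atTop atTop) (t : ℝ) :
    t < x 0 ∨ (∃ j, t ∈ Ico (x j) (x j + L j / C)) ∨
      ∃ j, t ∈ Ico (x j + L j / C) (x (j + 1)) := by
  classical
  have hex : ∃ j, t < x j := (hx.eventually_gt_atTop t).exists
  rcases hk : Nat.find hex with _ | j
  · left; have := Nat.find_spec hex; rwa [hk] at this
  · right
    have h1 : t < x (j + 1) := by have := Nat.find_spec hex; rwa [hk] at this
    have h2 : x j ≤ t := not_lt.1 (Nat.find_min hex (by omega))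
    rcases lt_or_ge t (x j + L j / C) with h3 | h3
    · exact Or.inl ⟨j, h2, h3⟩
    · exact Or.inr ⟨j, h3, h1⟩

/-- The number of bits sent up to the start of packet `j`, counted from the start of packet `m`. -/
theorem integral_packetStream (h : IsSchedule C L x) (hC : 0 < C) {m j : ℕ} (hmj : m ≤ j) :
    ∫ τ in x m..x j, packetStream C L x univ τ = ∑ i ∈ Finset.Ico m j, L i := by
  induction j, hmj using Nat.le_induction with
  | base => simp
  | succ j hj ih =>
    have ht := isTraffic_packetStream hC.le L x univ
    rw [← ht.integral_add (x m) (x j), ih, ← ht.integral_add (x j) (x j + L j / C),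
      Finset.sum_Ico_succ_top hj,
      IsTraffic.integral_eq_of_eq (R := packetStream C L x univ) C
        (by linarith [h.pos j] : x j ≤ x j + L j / C)
        fun t ht => packetStream_of_mem (mem_univ j) ht,
      IsTraffic.integral_eq_of_eq (R := packetStream C L x univ) 0 (h.le_succ j)
        fun t ht => h.packetStream_gap univ ht]
    field_simp
    ring

end IsSchedule

/-! ### The regulator along a fixed sequence of packets -/

/-- The standing assumptions on the parameters of the regulator and on a sequence of packets. -/
structure Admissible (p : Params) (s L : ℕ → ℝ) : Prop where
  rate_pos : 0 < p.ρ
  rate_lt : p.ρ < p.C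
  two_le : 2 ≤ p.M
  le_T_one : p.δ ≤ p.T 1
  le_T_sub : ∀ i, 1 ≤ i → i + 1 ≤ p.M → p.δ ≤ p.T (i + 1) - p.T i
  start_nonneg : 0 ≤ s 0
  length : ∀ j, 0 < L j ∧ L j ≤ p.Lmax
  separated : ∀ j, s j + L j / p.C < s (j + 1)
  tendsto : Tendsto s atTop atTop
  nonempty_B : ∀ j, (setB p s L (departure p s L) j).Nonempty

namespace Admissible

variable {p : Params} {s L : ℕ → ℝ}

local notation "dep" => departure p s L
local notation "arr" => serverArrival p s L (departure p s L)
local notation "load" => serverWorkload p s L (departure p s L)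
local notation "Wout" => workload p.ρ (outputStream p s L)

theorem capacity_pos (h : Admissible p s L) : 0 < p.C := h.rate_pos.trans h.rate_lt

theorem δ_pos (h : Admissible p s L) : 0 < p.δ := by
  have h1 : p.ρ / p.C < 1 := (div_lt_one h.capacity_pos).2 h.rate_lt
  have h2 : 0 < p.Lmax := (h.length 0).1.trans_le (h.length 0).2
  exact mul_pos (by linarith) h2

theorem T_mono (h : Admissible p s L) {i k : ℕ} (hi : 1 ≤ i) (hik : i ≤ k) (hk : k ≤ p.M) :
    p.T i ≤ p.T k := by
  induction k, hik using Nat.le_induction with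
  | base => exact le_rfl
  | succ k hk' ih =>
    have := h.le_T_sub k (hi.trans hk') hk
    linarith [ih (by omega), h.δ_pos]

theorem T_pos (h : Admissible p s L) {i : ℕ} (hi : 1 ≤ i) (hiM : i ≤ p.M) : 0 < p.T i := by
  linarith [h.T_mono le_rfl hi hiM, h.le_T_one, h.δ_pos]

/-- This is what the spacing of the thresholds by `δ` is for: a load not above `T i` already fits
into the burst size with index `i + 1`. -/
theorem T_le_σ (h : Admissible p s L) {i : ℕ} (hi : 1 ≤ i) (hiM : i + 1 ≤ p.M) :
    p.T i ≤ p.σ (i + 1) := by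
  have := h.le_T_sub i hi hiM
  unfold Params.σ; linarith

theorem σ_nonneg (h : Admissible p s L) {i : ℕ} (hi : 1 ≤ i) (hiM : i ≤ p.M) : 0 ≤ p.σ i := by
  unfold Params.σ; linarith [h.T_mono le_rfl hi hiM, h.le_T_one]

theorem length_div_pos (h : Admissible p s L) (j : ℕ) : 0 < L j / p.C :=
  div_pos (h.length j).1 h.capacity_pos

theorem sInf_mem_B (h : Admissible p s L) (j : ℕ) :
    sInf (setB p s L dep j) ∈ setB p s L dep j := Nat.sInf_mem (h.nonempty_B j)

/-- Only the default index `1` comes without an overshoot test; the final disjunction keeps track of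
this. -/
theorem exists_burst_eq (h : Admissible p s L) (j : ℕ) :
    ∃ l, 1 ≤ l ∧ l ≤ sInf (setB p s L dep j) ∧ burst p s L dep j = p.σ l ∧
      (l = 1 ∨ l ∈ setI p s L dep j) := by
  by_cases hI : (setI p s L dep j).Nonempty
  · have hm : sSup (setI p s L dep j) ∈ setI p s L dep j :=
      Nat.sSup_mem hI ⟨sInf (setB p s L dep j), fun l hl => hl.2.1⟩
    exact ⟨_, le_trans (by norm_num) hm.1, hm.2.1, by simp [burst, hI], Or.inr hm⟩
  · exact ⟨1, le_rfl, (h.sInf_mem_B j).1, by simp [burst, hI], Or.inl rfl⟩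

theorem burst_nonneg (h : Admissible p s L) (j : ℕ) : 0 ≤ burst p s L dep j := by
  obtain ⟨l, h1, h2, h3, -⟩ := h.exists_burst_eq j
  rw [h3]
  exact h.σ_nonneg h1 (h2.trans (h.sInf_mem_B j).2.1)

theorem departure_sub (h : Admissible p s L) (j : ℕ) :
    p.ρ * (dep j - arr j) = max (load j - burst p s L dep j) 0 := by
  have := h.rate_pos
  rw [departure_eq, candDeparture]
  field_simp
  ring

theorem arrival_le_departure (h : Admissible p s L) (j : ℕ) : arr j ≤ dep j := by
  have h1 := h.departure_sub j
  have h2 := le_max_right (load j - burst p s L dep j) 0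
  rw [← h1] at h2
  linarith [nonneg_of_mul_nonneg_right h2 h.rate_pos]

theorem start_le_arrival (j : ℕ) : s j ≤ arr j := by
  cases j with
  | zero => exact le_rfl
  | succ j => exact le_max_left _ _

theorem departure_add_le (j : ℕ) : dep j + L j / p.C ≤ arr (j + 1) := le_max_right _ _

theorem isSchedule_start (h : Admissible p s L) : IsSchedule p.C L s :=
  ⟨h.start_nonneg, h.length_div_pos, fun j => (h.separated j).le⟩

theorem isSchedule_departure (h : Admissible p s L) : IsSchedule p.C L dep :=
  ⟨(h.start_nonneg.trans (start_le_arrival 0)).trans (h.arrival_le_departure 0),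
    h.length_div_pos, fun j => (departure_add_le j).trans (h.arrival_le_departure (j + 1))⟩

theorem isSchedule_arrival (h : Admissible p s L) : IsSchedule p.C L arr :=
  ⟨h.start_nonneg.trans (start_le_arrival 0), h.length_div_pos, fun j => by
    linarith [departure_add_le (p := p) (s := s) (L := L) j, h.arrival_le_departure j]⟩

theorem tendsto_arrival (h : Admissible p s L) : Tendsto arr atTop atTop :=
  tendsto_atTop_mono start_le_arrival h.tendsto

theorem tendsto_departure (h : Admissible p s L) : Tendsto dep atTop atTop :=
  tendsto_atTop_mono h.arrival_le_departure h.tendsto_arrival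

theorem isTraffic_output (h : Admissible p s L) : IsTraffic p.C (outputStream p s L) :=
  isTraffic_packetStream h.capacity_pos.le _ _ _

theorem isTraffic_input (h : Admissible p s L) : IsTraffic p.C (inputStream p s L) :=
  isTraffic_packetStream h.capacity_pos.le _ _ _

theorem load_nonneg (h : Admissible p s L) (j : ℕ) : 0 ≤ load j :=
  (isTraffic_packetStream h.capacity_pos.le _ _ _).workload_nonneg (h.isSchedule_arrival.nonneg j)

theorem load_zero (h : Admissible p s L) : load 0 = 0 := by
  have ht := isTraffic_packetStream h.capacity_pos.le L arr (Iio 0)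
  have := ht.workload_of_idle h.rate_pos.le le_rfl (h.isSchedule_arrival.nonneg 0)
    fun t ht => h.isSchedule_arrival.packetStream_before _ ht.2
  rw [ht.workload_zero] at this
  unfold serverWorkload
  rw [this]
  exact max_eq_right (by nlinarith [h.rate_pos, h.isSchedule_arrival.nonneg 0])

/-- Lindley's recursion: between consecutive server arrivals the stream is first busy with packet
`j` and then idle, so a single truncation at `0` is enough. -/
theorem load_succ (h : Admissible p s L) (j : ℕ) :
    load (j + 1) = max (load j + L j - p.ρ * (arr (j + 1) - arr j)) 0 := by
  have hsch := h.isSchedule_arrival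
  have ht := isTraffic_packetStream h.capacity_pos.le L arr (Iio (j + 1))
  have h0 : workload p.ρ (packetStream p.C L arr (Iio (j + 1))) (arr j) = load j :=
    workload_congr fun τ hτ => hsch.packetStream_eq_of_lt (fun i hi => by simp; omega) hτ.2
  have h1 := ht.workload_of_busy h.rate_lt.le (hsch.nonneg j)
    (by linarith [hsch.pos j] : arr j ≤ arr j + L j / p.C)
    fun τ hτ => packetStream_of_mem (by simp) hτ
  have h2 := ht.workload_of_idle h.rate_pos.le (by linarith [hsch.pos j, hsch.nonneg j])
    (hsch.le_succ j) fun τ hτ => hsch.packetStream_gap _ hτ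
  have hC : p.C ≠ 0 := h.capacity_pos.ne'
  unfold serverWorkload at h0 ⊢
  rw [h2, h1, h0]
  congr 1
  field_simp
  ring

theorem output_idle_before (h : Admissible p s L) {j : ℕ} {t : ℝ} (ht : t ∈ Ico (arr j) (dep j)) :
    outputStream p s L t = 0 := by
  refine packetStream_of_forall_notMem fun i _ hi => ?_
  rcases lt_or_ge i j with hij | hij
  · obtain ⟨k, rfl⟩ : ∃ k, j = k + 1 := ⟨j - 1, by omega⟩
    have h1 := departure_add_le (p := p) (s := s) (L := L) k
    rcases (Nat.lt_succ_iff.1 hij).lt_or_eq with hik | rfl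
    · linarith [h.isSchedule_departure.finish_le hik, h.length_div_pos k, hi.2, ht.1]
    · linarith [hi.2, ht.1]
  · linarith [h.isSchedule_departure.strictMono.monotone hij, hi.1, ht.2]

theorem output_idle_after {j : ℕ} {t : ℝ} (h : Admissible p s L)
    (ht : t ∈ Ico (dep j + L j / p.C) (arr (j + 1))) : outputStream p s L t = 0 :=
  h.isSchedule_departure.packetStream_gap _ ⟨ht.1, ht.2.trans_le (h.arrival_le_departure _)⟩

/-- The draining of the workload until the departure of packet `j`, where the workload at the
arrival of packet `j` at the server is the one of the server input. -/
theorem workload_of_waiting (h : Admissible p s L) {j : ℕ} (hj : Wout (arr j) = load j) {t : ℝ}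
    (ht : t ∈ Icc (arr j) (dep j)) : Wout t = load j - p.ρ * (t - arr j) := by
  have h1 := h.isTraffic_output.workload_of_idle h.rate_pos.le (h.isSchedule_arrival.nonneg j) ht.1
    fun τ hτ => h.output_idle_before ⟨hτ.1, hτ.2.trans_le ht.2⟩
  rw [hj] at h1
  -- The truncation at zero is never active: waiting ends once the workload has drained to the burst
  -- size, which is nonnegative.
  rw [h1, max_eq_left]
  have h2 := h.departure_sub j
  have h3 : p.ρ * (t - arr j) ≤ p.ρ * (dep j - arr j) :=
    mul_le_mul_of_nonneg_left (by linarith [ht.2]) h.rate_pos.le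
  have h4 : max (load j - burst p s L dep j) 0 ≤ load j :=
    max_le (by linarith [h.burst_nonneg j]) (h.load_nonneg j)
  linarith

theorem workload_of_sending (h : Admissible p s L) {j : ℕ} (hj : Wout (arr j) = load j) {t : ℝ}
    (ht : t ∈ Icc (dep j) (dep j + L j / p.C)) :
    Wout t = load j + p.C * (t - dep j) - p.ρ * (t - arr j) := by
  have h1 := h.isTraffic_output.workload_of_busy h.rate_lt.le (h.isSchedule_departure.nonneg j) ht.1
    fun τ hτ => packetStream_of_mem (mem_univ j) ⟨hτ.1, hτ.2.trans_le ht.2⟩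
  rw [h1, h.workload_of_waiting hj ⟨h.arrival_le_departure j, le_rfl⟩]
  ring

theorem workload_of_draining (h : Admissible p s L) {j : ℕ} (hj : Wout (arr j) = load j) {t : ℝ}
    (ht : t ∈ Icc (dep j + L j / p.C) (arr (j + 1))) :
    Wout t = max (load j + L j - p.ρ * (t - arr j)) 0 := by
  have hp := h.length_div_pos j
  have h1 := h.isTraffic_output.workload_of_idle h.rate_pos.le
    (by linarith [h.isSchedule_departure.nonneg j]) ht.1
    fun τ hτ => h.output_idle_after ⟨hτ.1, hτ.2.trans_le ht.2⟩
  rw [h1, h.workload_of_sending hj ⟨by linarith, le_rfl⟩]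
  have hC : p.C ≠ 0 := h.capacity_pos.ne'
  congr 1
  field_simp
  ring

/-- The output workload agrees with the workload of the server input when a packet reaches the
server. -/
theorem workload_arrival (h : Admissible p s L) (j : ℕ) : Wout (arr j) = load j := by
  induction j with
  | zero =>
    have h1 := h.isTraffic_output.workload_of_idle h.rate_pos.le le_rfl
      (h.isSchedule_arrival.nonneg 0) fun t ht =>
        h.isSchedule_departure.packetStream_before _ (ht.2.trans_le (h.arrival_le_departure 0))
    rw [h1, h.isTraffic_output.workload_zero, h.load_zero]
    exact max_eq_right (by nlinarith [h.rate_pos, h.isSchedule_arrival.nonneg 0])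
  -- Delaying packet `j` inside `[arr j, arr (j + 1)]` does not affect the workload at the right
  -- end: the same bits arrive and none of the drain before the departure is lost at zero. So both
  -- workloads obey the same recursion.
  | succ j ih =>
    rw [h.workload_of_draining ih ⟨departure_add_le j, le_rfl⟩, h.load_succ]

theorem workload_departure (h : Admissible p s L) (j : ℕ) :
    Wout (dep j) = min (load j) (burst p s L dep j) := by
  rw [h.workload_of_waiting (h.workload_arrival j) ⟨h.arrival_le_departure j, le_rfl⟩,
    h.departure_sub]
  rcases le_total (load j) (burst p s L dep j) with hle | hle
  · rw [min_eq_left hle, max_eq_right (by linarith)]; ring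
  · rw [min_eq_right hle, max_eq_left (by linarith)]; ring

/-- Sending packet `j` raises the workload by `(C - ρ) L_j / C ≤ (1 - ρ / C) L_max`, which explains
the value of `δ`. -/
theorem workload_finish_le (h : Admissible p s L) (j : ℕ) :
    Wout (dep j + L j / p.C) ≤ min (load j) (burst p s L dep j) + p.δ := by
  have hp := h.length_div_pos j
  have h1 := h.isTraffic_output.workload_le_add h.rate_lt.le (h.isSchedule_departure.nonneg j)
    (by linarith : dep j ≤ dep j + L j / p.C)
  rw [h.workload_departure] at h1
  have h2 : (p.C - p.ρ) * (dep j + L j / p.C - dep j) ≤ p.δ := by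
    have hC : p.C ≠ 0 := h.capacity_pos.ne'
    have : (p.C - p.ρ) * (dep j + L j / p.C - dep j) = (1 - p.ρ / p.C) * L j := by
      field_simp; ring
    rw [this]
    exact mul_le_mul_of_nonneg_left (h.length j).2
      (by linarith [(div_lt_one h.capacity_pos).2 h.rate_lt])
  linarith

/-! ### The output workload is at most the input workload -/

/-- The recursion is unrolled back to the last packet `m` at which it was truncated to zero, or to
the first packet. Such a packet was not held up in the front-end buffer, so its server arrival is
its true arrival time `s m`. -/
theorem load_le_sum (h : Admissible p s L) (j : ℕ) :
    ∃ m ≤ j, load j ≤ ∑ i ∈ Finset.Ico m j, L i - p.ρ * (arr j - s m) := by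
  induction j with
  | zero => exact ⟨0, le_rfl, by simp [h.load_zero, serverArrival]⟩
  | succ j ih =>
    obtain ⟨m, hm, hle⟩ := ih
    rw [h.load_succ]
    rcases le_or_gt 0 (load j + L j - p.ρ * (arr (j + 1) - arr j)) with h0 | h0
    · refine ⟨m, hm.trans (Nat.le_succ j), ?_⟩
      rw [max_eq_left h0, Finset.sum_Ico_succ_top hm]
      linarith
    · refine ⟨j + 1, le_rfl, ?_⟩
      rw [max_eq_right h0.le]
      have : arr (j + 1) = s (j + 1) := by
        -- Had the packet been held up, its server arrival would be the completion of packet `j`,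
        -- where the output workload equals the untruncated expression; that expression is negative
        -- by assumption.
        refine max_eq_left (le_of_not_gt fun hlt => ?_)
        have h1 : arr (j + 1) = dep j + L j / p.C := max_eq_right hlt.le
        have h2 := h.workload_of_sending (h.workload_arrival j)
          (t := dep j + L j / p.C) ⟨by linarith [h.length_div_pos j], le_rfl⟩
        have h3 := h.isTraffic_output.workload_nonneg (ρ := p.ρ)
          (by linarith [h.length_div_pos j, h.isSchedule_departure.nonneg j] :
            0 ≤ dep j + L j / p.C)
        have h4 : p.C * (dep j + L j / p.C - dep j) = L j := by
          have hC : p.C ≠ 0 := h.capacity_pos.ne'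
          field_simp; ring
        rw [h2, h4, ← h1] at h3
        linarith
      simp [this]

/-- Here `q` stands for the bits of packet `j` sent so far by the output; the hypothesis on `x` says
that the input has already delivered them. -/
theorem le_workload_input (h : Admissible p s L) {m j : ℕ} (hm : m ≤ j) {q x : ℝ} (hq : 0 ≤ q)
    (hqL : q ≤ L j) (hx : s j + q / p.C ≤ x) :
    ∑ i ∈ Finset.Ico m j, L i + q - p.ρ * (x - s m) ≤
      workload p.ρ (inputStream p s L) x := by
  have ht := h.isTraffic_input
  have hsch := h.isSchedule_start
  have hqC : 0 ≤ q / p.C := div_nonneg hq h.capacity_pos.le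
  have hmj : s m ≤ s j := hsch.strictMono.monotone hm
  refine le_trans ?_ (ht.le_workload (hsch.nonneg m) (by linarith))
  have h1 : ∫ τ in s m..s j, inputStream p s L τ = ∑ i ∈ Finset.Ico m j, L i :=
    hsch.integral_packetStream h.capacity_pos hm
  have h2 : ∫ τ in s j..s j + q / p.C, inputStream p s L τ = q := by
    rw [IsTraffic.integral_eq_of_eq (R := inputStream p s L) p.C
      (by linarith : s j ≤ s j + q / p.C) fun t ht => packetStream_of_mem (mem_univ j)
        ⟨ht.1, ht.2.trans_le (by
          have := div_le_div_of_nonneg_right hqL h.capacity_pos.le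
          linarith)⟩]
    have hC : p.C ≠ 0 := h.capacity_pos.ne'
    field_simp; ring
  have h3 := ht.integral_nonneg hx
  have h4 := ht.integral_add (s m) (s j) (s j + q / p.C)
  have h5 := ht.integral_add (s m) (s j + q / p.C) x
  linarith

/-- Every bit leaves no earlier than it came in. A positive output workload is therefore accounted
for by input bits that arrived since some `s m`. The three phases of packet `j` use `q = 0`, `q = C
(x - dep j)` and `q = L j`. -/
theorem workload_output_le (h : Admissible p s L) {x : ℝ} (hx : 0 ≤ x) :
    Wout x ≤ workload p.ρ (inputStream p s L) x := by
  have hin := h.isTraffic_input.workload_nonneg (ρ := p.ρ) hx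
  have key : ∀ j, ∀ q, 0 ≤ q → q ≤ L j → s j + q / p.C ≤ x →
      load j + q - p.ρ * (x - arr j) ≤ workload p.ρ (inputStream p s L) x := by
    intro j q hq hqL hqx
    obtain ⟨m, hm, hle⟩ := h.load_le_sum j
    have := h.le_workload_input hm hq hqL hqx
    linarith
  have hC := h.capacity_pos
  have main : ∀ j, x ∈ Ico (arr j) (arr (j + 1)) → Wout x ≤
      workload p.ρ (inputStream p s L) x := by
    intro j hj
    have hsj : s j ≤ arr j := start_le_arrival j
    have had := h.arrival_le_departure j
    rcases le_total x (dep j) with h1 | h1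
    · have := key j 0 le_rfl (h.length j).1.le (by simpa using hsj.trans hj.1)
      rw [h.workload_of_waiting (h.workload_arrival j) ⟨hj.1, h1⟩]
      linarith
    rcases le_total x (dep j + L j / p.C) with h2 | h2
    · rw [h.workload_of_sending (h.workload_arrival j) ⟨h1, h2⟩]
      refine key j _ (mul_nonneg hC.le (by linarith)) ?_ ?_
      · have : x - dep j ≤ L j / p.C := by linarith
        rw [le_div_iff₀ hC] at this
        linarith
      · rw [mul_div_cancel_left₀ _ hC.ne']
        linarith
    · rw [h.workload_of_draining (h.workload_arrival j) ⟨h2, hj.2.le⟩]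
      exact max_le (key j _ (h.length j).1.le le_rfl (by linarith)) hin
  rcases IsSchedule.exists_location (C := p.C) (L := L)
    h.tendsto_arrival x with h0 | ⟨j, hj⟩ | ⟨j, hj⟩
  · have h1 := h.isTraffic_output.workload_of_idle h.rate_pos.le le_rfl hx fun t ht =>
      h.isSchedule_departure.packetStream_before _
        (ht.2.trans (h0.trans_le (h.arrival_le_departure 0)))
    rw [h1, h.isTraffic_output.workload_zero]
    exact max_le (by nlinarith [h.rate_pos]) hin
  · exact main j ⟨hj.1, hj.2.trans_le (h.isSchedule_arrival.le_succ j)⟩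
  · exact main j ⟨by linarith [hj.1, h.length_div_pos j], hj.2⟩

/-! ### Upcrossings of a threshold -/

/-- Later packets start only after packet `j` is complete, so the test made with the chosen burst
size speaks about the actual output stream. -/
theorem overshootRatio_candOutput (h : Admissible p s L) (j : ℕ) (ζ : ℝ) :
    overshootRatio p.ρ (candOutput p s L dep j (burst p s L dep j)) ζ
        (candFinish p s L dep j (burst p s L dep j)) =
      overshootRatio p.ρ (outputStream p s L) ζ (dep j + L j / p.C) := by
  have h1 : candFinish p s L dep j (burst p s L dep j) = dep j + L j / p.C := by
    rw [candFinish, ← departure_eq]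
  have h2 : candOutput p s L dep j (burst p s L dep j) = packetStream p.C L dep (Iic j) := by
    rw [candOutput, ← departure_eq, Function.update_eq_self]
  rw [h1, h2]
  unfold overshootRatio overshootDuration
  have hset : ∀ A B : ℝ → Prop, (∀ τ, A τ ↔ B τ) → {τ | A τ} = {τ | B τ} := fun A B hAB => by
    congr 1; funext τ; exact propext (hAB τ)
  rw [hset _ (fun τ => τ ∈ Icc 0 (dep j + L j / p.C) ∧ ζ ≤ Wout τ) fun τ => ?_]
  refine and_congr_right fun hτ => ?_
  rw [workload_congr (R' := outputStream p s L) fun x hx =>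
    h.isSchedule_departure.packetStream_eq_of_lt (j := j + 1) (J' := univ)
      (fun i hi => by simp; omega)
      (hx.2.trans_le (hτ.2.trans (h.isSchedule_departure.le_succ j)))]

/-- A packet that lifts the workload above `T i` has been admitted with burst size `σ (i + 1)`. -/
theorem overshootRatio_le_of_lift (h : Admissible p s L) {i j : ℕ} (hi : 1 ≤ i) (hiM : i + 1 ≤ p.M)
    (hlow : Wout (dep j) ≤ p.T i) (hhigh : p.T i < Wout (dep j + L j / p.C)) :
    overshootRatio p.ρ (outputStream p s L) (p.T i) (dep j + L j / p.C) ≤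
      p.bound (p.T (i + 1)) := by
  obtain ⟨l, hl1, hlB, hσ, hl⟩ := h.exists_burst_eq j
  have hlM := hlB.trans (h.sInf_mem_B j).2.1
  rw [h.workload_departure, hσ] at hlow
  have h1 := h.workload_finish_le j
  rw [hσ] at h1
  -- An index `l ≤ i` would leave the workload at completion at most `σ l + δ = T l ≤ T i`.
  have hil : i < l := by
    by_contra hcon
    have h2 := h.T_mono hl1 (not_lt.1 hcon) (by omega)
    have h3 : p.σ l + p.δ = p.T l := by simp [Params.σ]
    linarith [min_le_right (load j) (p.σ l)]
  -- If `l > i + 1`, the low workload at departure must come from the load itself, since `σ l > σ (i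
  -- + 1) ≥ T i`. Then `i + 1 ∈ 𝓑_j`, contradicting `l ≤ min 𝓑_j`.
  have hli : l = i + 1 := by
    by_contra hcon
    have h2 : p.T (i + 1) < p.T l := by
      have := h.le_T_sub (i + 1) (by omega) (by omega)
      linarith [h.T_mono (i := i + 1 + 1) (k := l) (by omega) (by omega) hlM, h.δ_pos]
    have h3 := h.T_le_σ hi hiM
    have h4 : p.σ (i + 1) < p.σ l := by unfold Params.σ; linarith
    have h5 : load j ≤ p.σ (i + 1) := by
      rcases min_le_iff.1 hlow with h6 | h6 <;> linarith
    have h6 : sInf (setB p s L dep j) ≤ i + 1 := Nat.sInf_le ⟨by omega, hiM, h5⟩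
    omega
  have hmem : l ∈ setI p s L dep j := hl.resolve_left (by omega)
  have h2 := hmem.2.2
  rw [← hσ, h.overshootRatio_candOutput, hli] at h2
  simpa using h2

/-- If the workload rises above the level `c`, then some packet lifts it above that level. -/
theorem exists_lift (h : Admissible p s L) {c u t : ℝ} (hc : 0 ≤ c) (hu : 0 ≤ u) (hut : u ≤ t)
    (hWu : Wout u ≤ c) (hWt : c < Wout t) :
    ∃ j, Wout (dep j) ≤ c ∧ c < Wout (dep j + L j / p.C) ∧ u ≤ dep j + L j / p.C ∧ dep j ≤ t := by
  have ht := h.isTraffic_output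
  have hcont : ContinuousOn Wout (Icc u t) :=
    (ht.continuousOn_workload h.rate_pos.le h.rate_lt.le).mono fun x hx => hu.trans hx.1
  have hcl : IsClosed (Icc u t ∩ Wout ⁻¹' Iic c) := hcont.preimage_isClosed_of_isClosed
    isClosed_Icc isClosed_Iic
  have hcomp : IsCompact (Icc u t ∩ Wout ⁻¹' Iic c) :=
    isCompact_Icc.of_isClosed_subset hcl inter_subset_left
  -- `v` is the last time at or below level `c`. The workload does not rise above `c` while the
  -- stream is idle, so `v` falls inside a packet, and that packet does the lifting.
  obtain ⟨v, ⟨hv, hvc⟩, hmax⟩ := hcomp.exists_isGreatest ⟨u, ⟨le_rfl, hut⟩, hWu⟩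
  have hvc : Wout v ≤ c := hvc
  have hv0 : 0 ≤ v := hu.trans hv.1
  have hvt : v < t := lt_of_le_of_ne hv.2 fun he => by rw [he] at hvc; linarith
  have habove : ∀ y, v < y → y ≤ t → c < Wout y := fun y hy hyt => by
    by_contra hcon
    exact absurd (hmax ⟨⟨hv.1.trans hy.le, hyt⟩, not_lt.1 hcon⟩) (not_le.2 hy)
  have idle : ∀ y, v < y → y ≤ t → (∀ x ∈ Ico v y, outputStream p s L x = 0) → False := by
    intro y hy hyt hx
    have h1 := habove y hy hyt
    rw [ht.workload_of_idle h.rate_pos.le hv0 hy.le hx] at h1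
    rcases lt_max_iff.1 h1 with h2 | h2
    · nlinarith [h.rate_pos]
    · linarith
  rcases IsSchedule.exists_location (C := p.C) (L := L)
    h.tendsto_departure v with h0 | ⟨j, hj⟩ | ⟨j, hj⟩
  · refine (idle (min t (dep 0)) (lt_min hvt h0) (min_le_left _ _) fun x hx => ?_).elim
    exact h.isSchedule_departure.packetStream_before _ (hx.2.trans_le (min_le_right _ _))
  · have hC := h.rate_lt
    have hup : ∀ x y, dep j ≤ x → x ≤ y → y ≤ dep j + L j / p.C → Wout x ≤ Wout y := by
      intro x y hx hxy hy
      rw [ht.workload_of_busy h.rate_lt.le ((h.isSchedule_departure.nonneg j).trans hx) hxy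
        fun τ hτ => packetStream_of_mem (mem_univ j) ⟨hx.trans hτ.1, hτ.2.trans_le hy⟩]
      nlinarith
    refine ⟨j, (hup _ v le_rfl hj.1 hj.2.le).trans hvc, ?_, hv.1.trans hj.2.le, hj.1.trans hv.2⟩
    exact (habove (min t (dep j + L j / p.C)) (lt_min hvt hj.2) (min_le_left _ _)).trans_le
      (hup _ _ (le_min (hj.1.trans hv.2) (hj.1.trans hj.2.le)) (min_le_right _ _) le_rfl)
  · refine (idle (min t (dep (j + 1))) (lt_min hvt hj.2) (min_le_left _ _) fun x hx => ?_).elim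
    exact h.isSchedule_departure.packetStream_gap _
      ⟨hj.1.trans hx.1, hx.2.trans_le (min_le_right _ _)⟩

/-- A positive level is attained at countably many times only. -/
theorem countable_level (h : Admissible p s L) {c : ℝ} (hc : 0 < c) :
    {τ | 0 ≤ τ ∧ Wout τ = c}.Countable := by
  have ht := h.isTraffic_output
  have hsch := h.isSchedule_departure
  -- On each busy or idle interval the workload, where positive, is affine with nonzero slope, so it
  -- meets the level at most once there.
  have idle : ∀ a b, 0 ≤ a → (∀ x ∈ Ico a b, outputStream p s L x = 0) →
      {τ | τ ∈ Ico a b ∧ Wout τ = c}.Subsingleton := by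
    rintro a b ha hab x ⟨hx, hxc⟩ y ⟨hy, hyc⟩
    have aux : ∀ z ∈ Ico a b, Wout z = c → Wout a - p.ρ * (z - a) = c := by
      intro z hz hzc
      rw [ht.workload_of_idle h.rate_pos.le ha hz.1 fun τ hτ => hab τ ⟨hτ.1, hτ.2.trans hz.2⟩]
        at hzc
      rcases max_choice (Wout a - p.ρ * (z - a)) 0 with h1 | h1 <;> rw [h1] at hzc
      · exact hzc
      · linarith
    have h1 := aux x hx hxc
    have h2 := aux y hy hyc
    have : p.ρ * x = p.ρ * y := by linarith
    exact mul_left_cancel₀ h.rate_pos.ne' this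
  have busy : ∀ j, {τ | τ ∈ Ico (dep j) (dep j + L j / p.C) ∧ Wout τ = c}.Subsingleton := by
    rintro j x ⟨hx, hxc⟩ y ⟨hy, hyc⟩
    have aux : ∀ z ∈ Ico (dep j) (dep j + L j / p.C), Wout z =
        Wout (dep j) + (p.C - p.ρ) * (z - dep j) := fun z hz =>
      ht.workload_of_busy h.rate_lt.le (hsch.nonneg j) hz.1
        fun τ hτ => packetStream_of_mem (mem_univ j) ⟨hτ.1, hτ.2.trans hz.2⟩
    have h1 := aux x hx
    have h2 := aux y hy
    have : (p.C - p.ρ) * x = (p.C - p.ρ) * y := by linarith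
    exact mul_left_cancel₀ (sub_pos.2 h.rate_lt).ne' this
  refine (((idle 0 (dep 0) le_rfl fun x hx => hsch.packetStream_before _ hx.2).countable.union
    (countable_iUnion fun j => (busy j).countable)).union
    (countable_iUnion fun j => (idle (dep j + L j / p.C) (dep (j + 1))
      (by linarith [h.length_div_pos j, hsch.nonneg j])
      fun x hx => hsch.packetStream_gap _ hx).countable)).mono ?_
  rintro τ ⟨hτ, hτc⟩
  rcases IsSchedule.exists_location (C := p.C) (L := L)
    h.tendsto_departure τ with h0 | ⟨j, hj⟩ | ⟨j, hj⟩
  · exact Or.inl (Or.inl ⟨⟨hτ, h0⟩, hτc⟩)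
  · exact Or.inl (Or.inr (mem_iUnion.2 ⟨j, hj, hτc⟩))
  · exact Or.inr (mem_iUnion.2 ⟨j, hj, hτc⟩)

end Admissible

/-! ### Overshoot durations -/

theorem measure_ne_top_of_subset_Icc {A : Set ℝ} {a b : ℝ} (h : A ⊆ Icc a b) :
    volume A ≠ ⊤ := ((measure_mono h).trans_lt measure_Icc_lt_top).ne

theorem measureReal_mono_of_Icc {A B : Set ℝ} {a b : ℝ} (h : A ⊆ B) (hB : B ⊆ Icc a b) :
    volume.real A ≤ volume.real B := measureReal_mono h (measure_ne_top_of_subset_Icc hB)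

theorem measureReal_le_add_of_subset {A B : Set ℝ} {a b c d : ℝ} (hab : a ≤ b)
    (hB : B ⊆ Icc c d) (h : A ⊆ B ∪ Icc a b) : volume.real A ≤ volume.real B + (b - a) := by
  have h1 : volume.real A ≤ volume.real (B ∪ Icc a b) :=
    measureReal_mono h (measure_union_ne_top (measure_ne_top_of_subset_Icc hB)
      measure_Icc_lt_top.ne)
  have h2 := measureReal_union_le (μ := volume) B (Icc a b)
  rw [Real.volume_real_Icc_of_le hab] at h2
  linarith

section Overshoot

variable {C ρ : ℝ} {R : ℝ → ℝ}

theorem overshootDuration_mono (ζ : ℝ) {a b : ℝ} (hab : a ≤ b) :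
    overshootDuration ρ R ζ a ≤ overshootDuration ρ R ζ b :=
  measureReal_mono_of_Icc (fun _ hτ => ⟨⟨hτ.1.1, hτ.1.2.trans hab⟩, hτ.2⟩) fun _ hτ => hτ.1

theorem overshootDuration_antitone {ζ ζ' : ℝ} (h : ζ ≤ ζ') (t : ℝ) :
    overshootDuration ρ R ζ' t ≤ overshootDuration ρ R ζ t :=
  measureReal_mono_of_Icc (fun _ hτ => ⟨hτ.1, h.trans hτ.2⟩) fun _ hτ => hτ.1

theorem overshootDuration_le_add (ζ : ℝ) {a b : ℝ} (hab : a ≤ b) :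
    overshootDuration ρ R ζ b ≤ overshootDuration ρ R ζ a + (b - a) := by
  refine measureReal_le_add_of_subset hab (c := 0) (d := a) (fun _ hτ => hτ.1) fun τ hτ => ?_
  rcases le_total τ a with h | h
  · exact Or.inl ⟨⟨hτ.1.1, h⟩, hτ.2⟩
  · exact Or.inr ⟨h, hτ.1.2⟩

theorem IsTraffic.measurableSet_overshoot (h : IsTraffic C R) (hρ : 0 ≤ ρ) (hC : ρ ≤ C) (ζ t : ℝ) :
    MeasurableSet {τ | τ ∈ Icc 0 t ∧ ζ ≤ workload ρ R τ} :=
  (((h.continuousOn_workload hρ hC).mono fun _ hx => hx.1).preimage_isClosed_of_isClosed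
    (isClosed_Icc (a := 0) (b := t)) (isClosed_Ici (a := ζ))).measurableSet

end Overshoot

/-! ### Rare long excursions -/

/-- The times in `[0, t]` at which `W` has been at least `c` for `K` time units. -/
def longExcursion (W : ℝ → ℝ) (c K t : ℝ) : Set ℝ :=
  {τ | τ ∈ Icc 0 t ∧ ∀ u ∈ Icc 0 τ, τ - K ≤ u → c ≤ W u}

/-- Long excursions of `W` above `c` take an arbitrarily small fraction of time. -/
def RareLongExcursions (W : ℝ → ℝ) (c : ℝ) : Prop :=
  ∀ η : ℝ, 0 < η → ∃ K : ℝ, 0 < K ∧ ∀ᶠ t in atTop, volume.real (longExcursion W c K t) ≤ η * t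

theorem RareLongExcursions.mono {W W' : ℝ → ℝ} {c : ℝ} (h : RareLongExcursions W c)
    (hW : ∀ t, 0 ≤ t → W' t ≤ W t) : RareLongExcursions W' c := by
  intro η hη
  obtain ⟨K, hK, hev⟩ := h η hη
  refine ⟨K, hK, hev.mono fun t ht => le_trans ?_ ht⟩
  exact measureReal_mono_of_Icc
    (fun τ hτ => ⟨hτ.1, fun u hu huK => (hτ.2 u hu huK).trans (hW u hu.1)⟩) fun τ hτ => hτ.1

/-- If `W` stayed above `c` throughout the last `ε t` time units, all but the first `K` of them
would belong to long excursions, which is more than the allowed `ε t / 2`. Capping `ε` at `1` keeps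
the window inside `[0, t]`. -/
theorem RareLongExcursions.eventually_exists_lt {W : ℝ → ℝ} {c : ℝ} (h : RareLongExcursions W c)
    {η : ℝ} (hη : 0 < η) : ∀ᶠ t in atTop, ∃ u ∈ Icc 0 t, t - η * t ≤ u ∧ W u < c := by
  set ε := min η 1 with hε
  have hε0 : 0 < ε := lt_min hη one_pos
  obtain ⟨K, hK, hev⟩ := h (ε / 2) (half_pos hε0)
  filter_upwards [hev, eventually_gt_atTop (2 * K / ε), eventually_ge_atTop 0] with t ht htK ht0
  by_contra hcon
  push Not at hcon
  have h1 : ε * t ≤ η * t := mul_le_mul_of_nonneg_right (min_le_left _ _) ht0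
  have h2 : ε * t ≤ t := by nlinarith [min_le_right η 1]
  rw [div_lt_iff₀ hε0] at htK
  have hsub : Icc (t - ε * t + K) t ⊆ longExcursion W c K t := by
    intro τ hτ
    refine ⟨⟨by linarith [hτ.1], hτ.2⟩, fun u hu huK => hcon u ⟨hu.1, hu.2.trans hτ.2⟩ ?_⟩
    linarith [hτ.1]
  have h3 := measureReal_mono_of_Icc hsub (a := 0) (b := t) fun τ hτ => hτ.1
  rw [Real.volume_real_Icc_of_le (by nlinarith)] at h3
  nlinarith

section Passage

variable {W : ℝ → ℝ} {α γ κ c K : ℝ}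

/-- The passage from `α` to `γ` takes time at least `(γ - α) / κ`. -/
theorem sub_le_measure_passage (hW : ContinuousOn W (Ici 0)) (hκ : 0 ≤ κ)
    (hlip : ∀ a b, 0 ≤ a → a ≤ b → W b ≤ W a + κ * (b - a)) {u τ : ℝ} (hu : 0 ≤ u)
    (huτ : u ≤ τ) (hWu : W u ≤ α) (hWτ : γ ≤ W τ) :
    γ - α ≤ κ * volume.real {x | x ∈ Icc u τ ∧ α ≤ W x ∧ W x < γ} := by
  have hcl : IsClosed (Icc u τ ∩ W ⁻¹' Ici γ) :=
    (hW.mono fun x hx => hu.trans hx.1).preimage_isClosed_of_isClosed isClosed_Icc isClosed_Ici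
  -- `v` is the first time at level `γ` or higher, and `w` below is the last time before `v` at
  -- level `α` or lower; in between the path stays in the strip.
  obtain ⟨v, ⟨hv, hvγ⟩, hmin⟩ := (isCompact_Icc.of_isClosed_subset hcl
    inter_subset_left).exists_isLeast ⟨τ, ⟨huτ, le_rfl⟩, hWτ⟩
  have hcl' : IsClosed (Icc u v ∩ W ⁻¹' Iic α) :=
    (hW.mono fun x hx => hu.trans hx.1).preimage_isClosed_of_isClosed isClosed_Icc isClosed_Iic
  obtain ⟨w, ⟨hw, hwα⟩, hmax⟩ := (isCompact_Icc.of_isClosed_subset hcl'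
    inter_subset_left).exists_isGreatest ⟨u, ⟨le_rfl, hv.1⟩, hWu⟩
  have hvγ : γ ≤ W v := hvγ
  have hwα : W w ≤ α := hwα
  have hsub : Ioo w v ⊆ {x | x ∈ Icc u τ ∧ α ≤ W x ∧ W x < γ} := by
    intro x hx
    refine ⟨⟨hw.1.trans hx.1.le, hx.2.le.trans hv.2⟩, ?_, ?_⟩
    · by_contra hcon
      exact absurd (hmax ⟨⟨hw.1.trans hx.1.le, hx.2.le⟩, (not_le.1 hcon).le⟩) (not_le.2 hx.1)
    · by_contra hcon
      exact absurd (hmin ⟨⟨hw.1.trans hx.1.le, hx.2.le.trans hv.2⟩, not_lt.1 hcon⟩)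
        (not_le.2 hx.2)
  have h1 := measureReal_mono_of_Icc hsub fun x hx => hx.1
  rw [Real.volume_real_Ioo_of_le hw.2] at h1
  have h2 := hlip w v (hu.trans hw.1) hw.2
  nlinarith [mul_le_mul_of_nonneg_left h1 hκ]

/-- Up to long excursions, the time spent above `γ` is bounded by a multiple of the time spent
between `α` and `γ`. -/
theorem measure_above_le (hW : ContinuousOn W (Ici 0)) (hκ : 0 ≤ κ)
    (hlip : ∀ a b, 0 ≤ a → a ≤ b → W b ≤ W a + κ * (b - a)) (hαγ : α < γ) (hc : c ≤ α)
    (hK : 0 < K) (t : ℝ) :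
    (γ - α) * volume.real {τ | τ ∈ Icc 0 t ∧ γ ≤ W τ} ≤
      (γ - α) * volume.real (longExcursion W c K t) +
        2 * K * κ * volume.real {x | x ∈ Icc 0 t ∧ α ≤ W x ∧ W x < γ} := by
  set D : ℝ → ℝ := fun t => volume.real {x | x ∈ Icc 0 t ∧ α ≤ W x ∧ W x < γ} with hD
  set G : ℝ → Set ℝ := fun t =>
    {τ | τ ∈ Icc 0 t ∧ γ ≤ W τ ∧ ∃ u ∈ Icc 0 τ, τ - K ≤ u ∧ W u < c} with hG
  have hD0 : ∀ t, 0 ≤ D t := fun t => measureReal_nonneg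
  have hDmono : ∀ a b, a ≤ b → D a ≤ D b := fun a b hab =>
    measureReal_mono_of_Icc (fun x hx => ⟨⟨hx.1.1, hx.1.2.trans hab⟩, hx.2⟩) fun x hx => hx.1
  have hpos : 0 < γ - α := sub_pos.2 hαγ
  -- Induction over blocks of length `K`. If `G` meets the last block, a whole climb from `α` to `γ`
  -- lies in `(t - 2 K, t]`, so `D t - D (t - 2 K) ≥ (γ - α) / κ` when `κ > 0`. This pays for the
  -- block, and these differences telescope to `D t + D (t - K)`.
  have key : ∀ n : ℕ, ∀ t ≤ n * K, (γ - α) * volume.real (G t) ≤ K * κ * (D t + D (t - K)) := by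
    intro n
    induction n with
    | zero =>
      intro t ht
      have h0 : volume.real (G t) ≤ volume.real (Icc (0 : ℝ) 0) :=
        measureReal_mono_of_Icc (a := 0) (b := 0)
          (fun τ hτ => ⟨hτ.1.1, hτ.1.2.trans (by simpa using ht)⟩) subset_rfl
      have h1 : volume.real (G t) = 0 := le_antisymm (by rwa [Real.volume_real_Icc_of_le le_rfl, sub_zero] at h0) measureReal_nonneg
      rw [h1, mul_zero]
      have := hD0 t
      have := hD0 (t - K)
      positivity
    | succ n ih =>
      intro t ht
      have hprev := ih (t - K) (by push_cast at ht; linarith)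
      by_cases hex : ∃ τ ∈ G t, t - K < τ
      · obtain ⟨τ, ⟨hτ, hτγ, u, hu, huK, hWu⟩, hτK⟩ := hex
        have h1 : volume.real (G t) ≤ volume.real (G (t - K)) + (t - (t - K)) := by
          refine measureReal_le_add_of_subset (by linarith) (c := 0) (d := t - K)
            (fun x hx => hx.1) fun x hx => ?_
          rcases le_total x (t - K) with hxK | hxK
          · exact Or.inl ⟨⟨hx.1.1, hxK⟩, hx.2⟩
          · exact Or.inr ⟨hxK, hx.1.2⟩
        have h2 := sub_le_measure_passage hW hκ hlip hu.1 hu.2 (hWu.le.trans hc) hτγ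
        have h3 : D (t - K - K) + volume.real {x | x ∈ Icc u τ ∧ α ≤ W x ∧ W x < γ} ≤ D t := by
          have hmeas : MeasurableSet {x | x ∈ Icc u τ ∧ α ≤ W x ∧ W x < γ} := by
            have hWI : ContinuousOn W (Icc u τ) := hW.mono fun x hx => hu.1.trans hx.1
            have hA := (hWI.preimage_isClosed_of_isClosed isClosed_Icc
              (isClosed_Ici (a := α))).measurableSet
            have hB := (hWI.preimage_isClosed_of_isClosed isClosed_Icc
              (isClosed_Ici (a := γ))).measurableSet
            refine (hA.diff hB).congr ?_
            ext x
            constructor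
            · rintro ⟨⟨hx, hxα⟩, hxγ⟩
              exact ⟨hx, hxα, not_le.1 fun hcon => hxγ ⟨hx, hcon⟩⟩
            · rintro ⟨hx, hxα, hxγ⟩
              exact ⟨⟨hx, hxα⟩, fun hcon => absurd hcon.2 (not_le.2 hxγ)⟩
          rw [← measureReal_union ?_ hmeas
            (measure_ne_top_of_subset_Icc (a := 0) (b := t - K - K) fun x hx => hx.1)
            (measure_ne_top_of_subset_Icc (a := u) (b := τ) fun x hx => hx.1)]
          · refine measureReal_mono_of_Icc (a := 0) (b := t) ?_ fun x hx => hx.1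
            rintro x (hx | hx)
            · exact ⟨⟨hx.1.1, by linarith [hx.1.2]⟩, hx.2⟩
            · exact ⟨⟨hu.1.trans hx.1.1, hx.1.2.trans hτ.2⟩, hx.2⟩
          · refine Set.disjoint_left.2 fun x hx hx' => ?_
            have h4 : x ≤ t - K - K := hx.1.2
            have h5 : u ≤ x := hx'.1.1
            linarith
        have h4 : (γ - α) * volume.real (G t) ≤ (γ - α) * volume.real (G (t - K)) + (γ - α) * K := by
          nlinarith
        have h5 : (γ - α) * K ≤ K * κ * (D t - D (t - K - K)) := by
          have h6 : κ * volume.real {x | x ∈ Icc u τ ∧ α ≤ W x ∧ W x < γ} ≤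
              κ * (D t - D (t - K - K)) := mul_le_mul_of_nonneg_left (by linarith) hκ
          nlinarith
        nlinarith
      · push Not at hex
        have h1 : volume.real (G t) ≤ volume.real (G (t - K)) :=
          measureReal_mono_of_Icc (a := 0) (b := t - K)
            (fun x hx => ⟨⟨hx.1.1, hex x hx⟩, hx.2⟩) fun x hx => hx.1
        have h2 := hDmono (t - K) t (by linarith)
        have h3 := hDmono (t - K - K) (t - K) (by linarith)
        have h4 : K * κ * (D (t - K) + D (t - K - K)) ≤ K * κ * (D t + D (t - K)) :=
          mul_le_mul_of_nonneg_left (by linarith) (by positivity)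
        nlinarith [mul_le_mul_of_nonneg_left h1 hpos.le]
  obtain ⟨n, hn⟩ := exists_nat_ge (t / K)
  rw [div_le_iff₀ hK] at hn
  have h1 := key n t hn
  have h2 : K * κ * (D t + D (t - K)) ≤ 2 * K * κ * D t := by
    have : K * κ * (D t + D (t - K)) ≤ K * κ * (D t + D t) :=
      mul_le_mul_of_nonneg_left (by linarith [hDmono (t - K) t (by linarith)]) (by positivity)
    linarith
  have h3 : volume.real {τ | τ ∈ Icc 0 t ∧ γ ≤ W τ} ≤
      volume.real (longExcursion W c K t) + volume.real (G t) := by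
    refine le_trans (measureReal_mono_of_Icc (a := 0) (b := t) ?_ ?_) (measureReal_union_le _ _)
    · intro τ hτ
      by_cases hL : τ ∈ longExcursion W c K t
      · exact Or.inl hL
      · right
        refine ⟨hτ.1, hτ.2, ?_⟩
        by_contra hcon
        push Not at hcon
        exact hL ⟨hτ.1, fun u hu huK => hcon u hu huK⟩
    · rintro τ (hτ | hτ) <;> exact hτ.1
  have h4 := mul_le_mul_of_nonneg_left h3 hpos.le
  linarith

end Passage
-- Long-run overshoot ratios of the regulated output
namespace Admissible

variable {p : Params} {s L : ℕ → ℝ}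

local notation "dep" => departure p s L
local notation "Wout" => workload p.ρ (outputStream p s L)
local notation "dur" => overshootDuration p.ρ (outputStream p s L)

/-- The overshoot duration at a time when the workload is above `T i`, if the workload was at most
`T i` shortly before. -/
theorem overshootDuration_le_of_lift (h : Admissible p s L) {i : ℕ} (hi : 1 ≤ i)
    (hiM : i + 1 ≤ p.M) {β : ℝ} (hβ : 0 ≤ β) (hbound : p.bound (p.T (i + 1)) ≤ β) {u t : ℝ}
    (hu : 0 ≤ u) (hut : u ≤ t) (hWu : Wout u ≤ p.T i) (hWt : p.T i < Wout t) :
    dur (p.T i) t ≤ β * (t + p.Lmax / p.C) + (t - u) := by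
  obtain ⟨j, hlow, hhigh, huj, hjt⟩ :=
    h.exists_lift (h.T_pos hi (by omega)).le hu hut hWu hWt
  have h1 := (h.overshootRatio_le_of_lift hi hiM hlow hhigh).trans hbound
  have hb : 0 < dep j + L j / p.C := by
    linarith [h.length_div_pos j, h.isSchedule_departure.nonneg j]
  rw [overshootRatio, div_le_iff₀ hb] at h1
  have hLj : L j / p.C ≤ p.Lmax / p.C :=
    div_le_div_of_nonneg_right (h.length j).2 h.capacity_pos.le
  have h2 : β * (dep j + L j / p.C) ≤ β * (t + p.Lmax / p.C) :=
    mul_le_mul_of_nonneg_left (by linarith) hβ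
  rcases le_total t (dep j + L j / p.C) with h3 | h3
  · have := overshootDuration_mono (ρ := p.ρ) (R := outputStream p s L) (p.T i) h3
    linarith
  · have := overshootDuration_le_add (ρ := p.ρ) (R := outputStream p s L) (p.T i) h3
    linarith

/-- The bound is proved at a time `τ` close to the last visit above `T i`: a low point precedes it
by at most `η τ / 2`, and the packet lifting the workload in between certifies the ratio. After `τ`
at most one time unit is added. -/
theorem eventually_overshootDuration_le (h : Admissible p s L)
    (hrare : RareLongExcursions Wout (p.T 1)) {i : ℕ} (hi : 1 ≤ i) (hiM : i + 1 ≤ p.M) {β : ℝ}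
    (hβ : 0 ≤ β) (hbound : p.bound (p.T (i + 1)) ≤ β) {η : ℝ} (hη : 0 < η) :
    ∀ᶠ t in atTop, dur (p.T i) t ≤ (β + η) * t := by
  obtain ⟨t₀, ht₀⟩ := eventually_atTop.1
    ((hrare.eventually_exists_lt (half_pos hη)).and (eventually_ge_atTop 0))
  have ht₀0 : 0 ≤ t₀ := (ht₀ t₀ le_rfl).2
  have hTi := h.T_pos hi (by omega)
  have hlev : volume {τ | 0 ≤ τ ∧ Wout τ = p.T i} = 0 := (h.countable_level hTi).measure_zero _
  -- Overshoot durations count the times at the level itself, whereas a lift is guaranteed only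
  -- before times strictly above it; the difference is a null set.
  have hlevel : ∀ A B : Set ℝ, A ⊆ B ∪ {τ | 0 ≤ τ ∧ Wout τ = p.T i} → volume B ≠ ⊤ →
      volume.real A ≤ volume.real B := by
    intro A B hAB hB
    have h1 : volume A ≤ volume B :=
      (measure_mono hAB).trans ((measure_union_le _ _).trans (by rw [hlev, add_zero]))
    exact ENNReal.toReal_mono hB h1
  -- The terms cover the initial period, the lifting packet that may finish after `τ`, and the
  -- choice of `τ` within one unit of a supremum that need not be attained.
  set c := t₀ + β * (p.Lmax / p.C) + 1 with hc
  have hLC : 0 ≤ p.Lmax / p.C :=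
    div_nonneg ((h.length 0).1.le.trans (h.length 0).2) h.capacity_pos.le
  have main : ∀ t, 0 ≤ t → dur (p.T i) t ≤ β * t + η / 2 * t + c := by
    intro t ht
    by_cases hne : ({τ | τ ∈ Icc t₀ t ∧ p.T i < Wout τ} : Set ℝ).Nonempty
    · have hbdd : BddAbove ({τ | τ ∈ Icc t₀ t ∧ p.T i < Wout τ} : Set ℝ) :=
        ⟨t, fun τ hτ => hτ.1.2⟩
      obtain ⟨τ, ⟨hτ, hWτ⟩, hlt⟩ := exists_lt_of_lt_csSup hne
        (sub_one_lt (sSup {τ | τ ∈ Icc t₀ t ∧ p.T i < Wout τ}))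
      have hsub : {x | x ∈ Icc 0 t ∧ p.T i ≤ Wout x} ⊆
          ({x | x ∈ Icc 0 τ ∧ p.T i ≤ Wout x} ∪ Icc τ (τ + 1)) ∪
            {τ | 0 ≤ τ ∧ Wout τ = p.T i} := by
        rintro x ⟨hx, hWx⟩
        rcases hWx.lt_or_eq with hlt' | heq
        · left
          rcases le_total x τ with hxτ | hxτ
          · exact Or.inl ⟨⟨hx.1, hxτ⟩, hWx⟩
          · right
            have := le_csSup hbdd (show x ∈ {τ | τ ∈ Icc t₀ t ∧ p.T i < Wout τ} from
              ⟨⟨hτ.1.trans hxτ, hx.2⟩, hlt'⟩)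
            exact ⟨hxτ, by linarith⟩
        · exact Or.inr ⟨hx.1, heq.symm⟩
      have h1 := hlevel _ _ hsub (measure_union_ne_top
        (measure_ne_top_of_subset_Icc fun x hx => hx.1) measure_Icc_lt_top.ne)
      have h2 := h1.trans (measureReal_le_add_of_subset (by linarith) (fun x hx => hx.1) subset_rfl)
      obtain ⟨⟨u, hu, hut, hWu⟩, -⟩ := ht₀ τ hτ.1
      have h3 := h.overshootDuration_le_of_lift hi hiM hβ hbound hu.1 hu.2
        (hWu.le.trans (h.T_mono le_rfl hi (by omega))) hWτ
      have h4 : β * τ ≤ β * t := mul_le_mul_of_nonneg_left hτ.2 hβ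
      have h5 : η / 2 * τ ≤ η / 2 * t := mul_le_mul_of_nonneg_left hτ.2 (half_pos hη).le
      have h6 : dur (p.T i) t ≤ dur (p.T i) τ + (τ + 1 - τ) := h2
      linarith
    · have hsub : {x | x ∈ Icc 0 t ∧ p.T i ≤ Wout x} ⊆
          Icc 0 t₀ ∪ {τ | 0 ≤ τ ∧ Wout τ = p.T i} := by
        rintro x ⟨hx, hWx⟩
        rcases hWx.lt_or_eq with hlt' | heq
        · left
          refine ⟨hx.1, ?_⟩
          by_contra hcon
          exact hne ⟨x, ⟨(not_le.1 hcon).le, hx.2⟩, hlt'⟩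
        · exact Or.inr ⟨hx.1, heq.symm⟩
      have h1 := hlevel _ _ hsub measure_Icc_lt_top.ne
      rw [Real.volume_real_Icc_of_le ht₀0] at h1
      have h2 : dur (p.T i) t ≤ t₀ - 0 := h1
      have h3 : 0 ≤ β * t := mul_nonneg hβ ht
      have h4 : 0 ≤ η / 2 * t := mul_nonneg (half_pos hη).le ht
      have h5 : 0 ≤ β * (p.Lmax / p.C) := mul_nonneg hβ hLC
      linarith
  filter_upwards [eventually_ge_atTop 0, eventually_ge_atTop (c / (η / 2))] with t ht htc
  rw [div_le_iff₀ (half_pos hη)] at htc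
  have := main t ht
  linarith

/-- Above `T i` the overshoot duration stays below the bound at the next threshold. -/
theorem eventually_overshootDuration_le_of_lt (h : Admissible p s L)
    (hrare : RareLongExcursions Wout (p.T 1)) {i : ℕ} (hi : 1 ≤ i) (hiM : i + 1 ≤ p.M) {β : ℝ}
    (hβ : 0 < β) (hbound : p.bound (p.T (i + 1)) ≤ β) {γ : ℝ} (hγ : p.T i < γ) :
    ∀ᶠ t in atTop, dur γ t ≤ β * t := by
  have ht := h.isTraffic_output
  have hκ : 0 < p.C - p.ρ := sub_pos.2 h.rate_lt
  have hpos : 0 < γ - p.T i := sub_pos.2 hγ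
  obtain ⟨K, hK, hev⟩ := hrare (β / 2) (half_pos hβ)
  -- Chosen so that, multiplied by `2 K (C - ρ)`, it gives `(γ - T i) β / 2`; the long excursions
  -- contribute the other half.
  have hε : 0 < (γ - p.T i) * β / (4 * K * (p.C - p.ρ)) := by positivity
  filter_upwards [hev, h.eventually_overshootDuration_le hrare hi hiM hβ.le hbound hε] with t h1 h2
  have h3 := measure_above_le (ht.continuousOn_workload h.rate_pos.le h.rate_lt.le) hκ.le
    (fun a b ha hab => ht.workload_le_add h.rate_lt.le ha hab) hγ
    (h.T_mono le_rfl hi (by omega)) hK t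
  have h4 : volume.real {x | x ∈ Icc 0 t ∧ p.T i ≤ Wout x ∧ Wout x < γ} + dur γ t ≤
      dur (p.T i) t := by
    unfold overshootDuration
    rw [← measureReal_union _ (ht.measurableSet_overshoot h.rate_pos.le h.rate_lt.le γ t)
      (measure_ne_top_of_subset_Icc (a := 0) (b := t) fun x hx => hx.1)
      (measure_ne_top_of_subset_Icc (a := 0) (b := t) fun x hx => hx.1)]
    · refine measureReal_mono_of_Icc (a := 0) (b := t) ?_ fun x hx => hx.1
      rintro x (hx | hx)
      · exact ⟨hx.1, hx.2.1⟩
      · exact ⟨hx.1, hγ.le.trans hx.2⟩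
    · exact Set.disjoint_left.2 fun x hx hx' => absurd hx'.2 (not_le.2 hx.2.2)
  have h3' : (γ - p.T i) * dur γ t ≤ (γ - p.T i) * volume.real (longExcursion Wout (p.T 1) K t) +
    2 * K * (p.C - p.ρ) * volume.real {x | x ∈ Icc 0 t ∧ p.T i ≤ Wout x ∧ Wout x < γ} := h3
  have h5 := mul_le_mul_of_nonneg_left h1 hpos.le
  have hKκ : 0 < 2 * K * (p.C - p.ρ) := by positivity
  have h6 := mul_le_mul_of_nonneg_left h4 hKκ.le
  have h7 := mul_le_mul_of_nonneg_left h2 hKκ.le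
  have h8 : 2 * K * (p.C - p.ρ) * ((β + (γ - p.T i) * β / (4 * K * (p.C - p.ρ))) * t) =
      2 * K * (p.C - p.ρ) * β * t + (γ - p.T i) * (β / 2) * t := by
    field_simp; ring
  rw [h8] at h7
  have h9 : (γ - p.T i + 2 * K * (p.C - p.ρ)) * dur γ t ≤
      (γ - p.T i + 2 * K * (p.C - p.ρ)) * (β * t) := by linarith
  exact le_of_mul_le_mul_left h9 (by linarith)

/-- Monotonicity in the level reduces uniformity over `γ` to two eventual bounds: a sharp one at
`γ₀`, and one at `T i` with error `f γ₀ - f e`. -/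
theorem eventually_overshootRatio_le_on (h : Admissible p s L)
    (hrare : RareLongExcursions Wout (p.T 1)) {i : ℕ} (hi : 1 ≤ i) (hiM : i + 1 ≤ p.M)
    {f : ℝ → ℝ} {e γ₀ : ℝ} (hf : AntitoneOn f (Icc (p.T i) e)) (hpos : 0 < f e)
    (hbound : p.bound (p.T (i + 1)) ≤ f e) (hγ₀ : γ₀ ∈ Ioo (p.T i) e) (hlt : f e < f γ₀) :
    ∀ᶠ t in atTop, ∀ γ ∈ Icc (p.T i) e, overshootRatio p.ρ (outputStream p s L) γ t ≤ f γ := by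
  filter_upwards [eventually_gt_atTop 0,
    h.eventually_overshootDuration_le_of_lt hrare hi hiM hpos hbound hγ₀.1,
    h.eventually_overshootDuration_le hrare hi hiM hpos.le hbound (sub_pos.2 hlt)]
    with t ht h1 h2 γ hγ
  rw [overshootRatio, div_le_iff₀ ht]
  have he : e ∈ Icc (p.T i) e := ⟨hγ₀.1.le.trans hγ₀.2.le, le_rfl⟩
  have hm : γ₀ ∈ Icc (p.T i) e := ⟨hγ₀.1.le, hγ₀.2.le⟩
  rcases le_total γ₀ γ with h3 | h3
  · refine (overshootDuration_antitone h3 t).trans (h1.trans ?_)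
    exact mul_le_mul_of_nonneg_right (hf hγ he hγ.2) ht.le
  · refine (overshootDuration_antitone hγ.1 t).trans (h2.trans ?_)
    exact mul_le_mul_of_nonneg_right (by linarith [hf hγ hm h3]) ht.le

/-- The regulator enforces the bound on the overshoot ratios if long excursions of the workload of
the input are rare. -/
theorem eventually_overshootRatio_le (h : Admissible p s L)
    (hrare : RareLongExcursions (workload p.ρ (inputStream p s L)) (p.T 1))
    {f : ℝ → ℝ} {Tlim : ℝ} (hTlim : p.δ ≤ Tlim - p.T (p.M - 1))
    (hf : AntitoneOn f (Icc 0 Tlim)) (hpos : ∀ γ ∈ Icc 0 Tlim, 0 < f γ)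
    (hstrict : ∀ i, 1 ≤ i → i + 2 ≤ p.M →
      ∃ γ ∈ Ioo (p.T i) (p.T (i + 1)), f (p.T (i + 1)) < f γ)
    (hstrict' : ∃ γ ∈ Ioo (p.T (p.M - 1)) Tlim, f Tlim < f γ)
    (hlower : ∀ γ ∈ Icc (p.T 1) Tlim, p.bound γ ≤ f γ)
    (hlast : p.bound (p.T p.M) ≤ f Tlim) :
    ∀ᶠ t in atTop, ∀ γ ∈ Icc (p.T 1) Tlim,
      overshootRatio p.ρ (outputStream p s L) γ t ≤ f γ := by
  have hrare' : RareLongExcursions Wout (p.T 1) := hrare.mono fun t ht => h.workload_output_le ht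
  have h2M := h.two_le
  have hle : ∀ i, 1 ≤ i → i + 1 ≤ p.M → p.T i ≤ Tlim := fun i hi hiM => by
    linarith [h.T_mono hi (by omega : i ≤ p.M - 1) (by omega), h.δ_pos]
  have hsub : ∀ i, 1 ≤ i → i + 1 ≤ p.M → ∀ e ≤ Tlim, AntitoneOn f (Icc (p.T i) e) :=
    fun i hi hiM e he => hf.mono (Icc_subset_Icc (h.T_pos hi (by omega)).le he)
  have hlow : ∀ i, 1 ≤ i → i + 2 ≤ p.M → ∀ᶠ t in atTop, ∀ γ ∈ Icc (p.T i) (p.T (i + 1)),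
      overshootRatio p.ρ (outputStream p s L) γ t ≤ f γ := by
    intro i hi hiM
    obtain ⟨γ₀, hγ₀, hlt⟩ := hstrict i hi hiM
    have hT := hle (i + 1) (by omega) hiM
    exact h.eventually_overshootRatio_le_on hrare' hi (by omega) (hsub i hi (by omega) _ hT)
      (hpos _ ⟨(h.T_pos (by omega) (by omega)).le, hT⟩)
      (hlower _ ⟨h.T_mono le_rfl (by omega) (by omega), hT⟩) hγ₀ hlt
  -- The last interval ends at `Tlim` rather than `T M`: the test performed there compares with the
  -- bound at `T M`, which is at most `f Tlim`.
  have htop : ∀ᶠ t in atTop, ∀ γ ∈ Icc (p.T (p.M - 1)) Tlim,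
      overshootRatio p.ρ (outputStream p s L) γ t ≤ f γ := by
    obtain ⟨γ₀, hγ₀, hlt⟩ := hstrict'
    have hM1 : p.M - 1 + 1 = p.M := by omega
    have hT := hle (p.M - 1) (by omega) (by omega)
    exact h.eventually_overshootRatio_le_on hrare' (by omega) (by omega)
      (hsub _ (by omega) (by omega) _ le_rfl)
      (hpos _ ⟨(h.T_pos (by omega) (by omega)).le.trans hT, le_rfl⟩)
      (by rwa [hM1]) hγ₀ hlt
  have hall : ∀ᶠ t in atTop, ∀ i ∈ Finset.Icc 1 (p.M - 2), ∀ γ ∈ Icc (p.T i) (p.T (i + 1)),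
      overshootRatio p.ρ (outputStream p s L) γ t ≤ f γ := by
    rw [eventually_all_finset]
    intro i hi
    rw [Finset.mem_Icc] at hi
    exact hlow i hi.1 (by omega)
  filter_upwards [hall, htop] with t h1 h2 γ hγ
  rcases le_total (p.T (p.M - 1)) γ with h3 | h3
  · exact h2 γ ⟨h3, hγ.2⟩
  · have hind : ∀ k, 1 ≤ k → k ≤ p.M - 1 → γ ≤ p.T k →
        overshootRatio p.ρ (outputStream p s L) γ t ≤ f γ := by
      intro k hk
      induction k, hk using Nat.le_induction with
      | base =>
        intro _ hγ1
        have hγ' : γ = p.T 1 := le_antisymm hγ1 hγ.1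
        rcases h2M.lt_or_eq with hM | hM
        · refine h1 1 (by simp; omega) γ ⟨hγ.1, ?_⟩
          rw [hγ']
          exact h.T_mono le_rfl (by omega) (by omega)
        · refine h2 γ ⟨?_, hγ.2⟩
          rw [hγ', ← hM]
      | succ k hk ih =>
        intro hkM hγk
        rcases le_total γ (p.T k) with h4 | h4
        · exact ih (by omega) h4
        · exact h1 k (Finset.mem_Icc.2 ⟨hk, by omega⟩) γ ⟨h4, hγk⟩
    exact hind (p.M - 1) (by omega) le_rfl h3

end Admissible

/-! ### Integrals as measurable functionals on path space -/

/-- The limit superior of the right Riemann sums of a path over `[0, t]`. -/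
noncomputable def pathIntegral (x : ℝ≥0 → ℝ) (t : ℝ≥0) : ℝ :=
  limsup (fun n : ℕ => (∑ k ∈ Finset.range ⌈t * (n + 1)⌉₊, x ((k + 1) / (n + 1))) / (n + 1)) atTop

/-- Events of path space depend on countably many coordinates only; the Riemann sums read a path at
rational times, which makes the functional measurable. -/
theorem measurable_pathIntegral (t : ℝ≥0) : Measurable fun x => pathIntegral x t :=
  Measurable.limsup fun _ => by fun_prop

/-- The time shift on path space. -/
def shift (u : ℝ≥0) (x : ℝ≥0 → ℝ) : ℝ≥0 → ℝ := fun t => x (t + u)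

theorem measurable_shift (u : ℝ≥0) : Measurable (shift u) :=
  measurable_pi_lambda _ fun _ => measurable_pi_apply _

theorem shift_shift (u v : ℝ≥0) (x : ℝ≥0 → ℝ) : shift u (shift v x) = shift (u + v) x := by
  funext t; simp [shift, add_assoc]

theorem iterate_shift (h : ℝ≥0) (k : ℕ) (x : ℝ≥0 → ℝ) : (shift h)^[k] x = shift (k * h) x := by
  induction k with
  | zero => funext t; simp [shift]
  | succ k ih =>
    rw [Function.iterate_succ_apply', ih, shift_shift]
    congr 1; push_cast; ring

theorem tendsto_floor_add_one_div {τ : ℝ} (hτ : 0 ≤ τ) :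
    Tendsto (fun n : ℕ => ((⌊τ * (n + 1)⌋₊ : ℝ) + 1) / (n + 1)) atTop (𝓝[≥] τ) := by
  have hlow : ∀ n : ℕ, τ ≤ ((⌊τ * (n + 1)⌋₊ : ℝ) + 1) / (n + 1) := fun n => by
    rw [le_div_iff₀ (by positivity)]
    exact (Nat.lt_floor_add_one _).le
  refine tendsto_nhdsWithin_iff.2 ⟨?_, Eventually.of_forall hlow⟩
  have hup : ∀ n : ℕ, ((⌊τ * (n + 1)⌋₊ : ℝ) + 1) / (n + 1) ≤ τ + 1 / ((n : ℝ) + 1) := fun n => by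
    have h1 : (⌊τ * (n + 1)⌋₊ : ℝ) ≤ τ * (n + 1) := Nat.floor_le (by positivity)
    have h2 : (0 : ℝ) < n + 1 := by positivity
    rw [div_le_iff₀ h2, add_mul, div_mul_cancel₀ _ h2.ne']
    linarith
  have h3 : Tendsto (fun n : ℕ => τ + 1 / ((n : ℝ) + 1)) atTop (𝓝 τ) := by
    simpa using tendsto_const_nhds.add (tendsto_one_div_add_atTop_nhds_zero_nat (𝕜 := ℝ))
  exact tendsto_of_tendsto_of_tendsto_of_le_of_le tendsto_const_nhds h3 hlow hup

/-- `R` is right-continuous at all times of `[0, ∞)`. -/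
def IsRightContinuous (R : ℝ → ℝ) : Prop := ∀ τ, 0 ≤ τ → ContinuousWithinAt R (Ici τ) τ

/-- The sums are integrals of step functions that sample `R` slightly to the right of each time, so
right-continuity and dominated convergence apply. Rounding up the number of cells adds at most `C /
(n + 1)`. -/
theorem IsTraffic.pathIntegral_eq {C : ℝ} {R : ℝ → ℝ} (h : IsTraffic C R)
    (hR : IsRightContinuous R) (t : ℝ≥0) :
    pathIntegral (fun τ => R τ) t = ∫ τ in (0 : ℝ)..t, R τ := by
  have hC : 0 ≤ C := (h.nonneg 0).trans (h.le 0)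
  set g : ℕ → ℝ → ℝ := fun n τ => R (((⌊τ * (n + 1)⌋₊ : ℝ) + 1) / (n + 1)) with hg
  have hgt : ∀ n, IsTraffic C (g n) := fun n =>
    ⟨h.measurable.comp (((Nat.measurable_floor.comp (measurable_id.mul_const _)).comp
      measurable_id |> measurable_from_nat.comp).add_const _ |>.div_const _),
      fun t => h.nonneg _, fun t => h.le _⟩
  have hlim : Tendsto (fun n => ∫ τ in (0 : ℝ)..t, g n τ) atTop (𝓝 (∫ τ in (0 : ℝ)..t, R τ)) := by
    refine intervalIntegral.tendsto_integral_filter_of_dominated_convergence (fun _ => C)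
      (Eventually.of_forall fun n => (hgt n).measurable.aestronglyMeasurable)
      (Eventually.of_forall fun n => Eventually.of_forall fun τ _ => ?_)
      intervalIntegrable_const (Eventually.of_forall fun τ hτ => ?_)
    · rw [Real.norm_of_nonneg ((hgt n).nonneg τ)]; exact (hgt n).le τ
    · rw [uIoc_of_le t.coe_nonneg] at hτ
      exact (hR τ hτ.1.le).tendsto.comp (tendsto_floor_add_one_div hτ.1.le)
  have hsum : ∀ n : ℕ, (∑ k ∈ Finset.range ⌈t * (n + 1)⌉₊,
      R (((k + 1) / (n + 1) : ℝ≥0) : ℝ)) / (n + 1) =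
      ∫ τ in (0 : ℝ)..(⌈t * (n + 1)⌉₊ : ℝ) / (n + 1), g n τ := by
    intro n
    have hn : (0 : ℝ) < n + 1 := by positivity
    have h1 := intervalIntegral.sum_integral_adjacent_intervals (f := g n) (μ := volume)
      (a := fun k : ℕ => (k : ℝ) / (n + 1)) (n := ⌈t * (n + 1)⌉₊)
      fun k _ => (hgt n).intervalIntegrable _ _
    simp only [Nat.cast_zero, zero_div] at h1
    rw [← h1, Finset.sum_div]
    refine Finset.sum_congr rfl fun k _ => ?_
    rw [IsTraffic.integral_eq_of_eq (R := g n) (R (((k + 1) / (n + 1) : ℝ≥0) : ℝ))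
      (div_le_div_of_nonneg_right (by push_cast; linarith) hn.le)]
    · push_cast; field_simp; ring
    · intro τ hτ
      have h2 : ⌊τ * (n + 1)⌋₊ = k := by
        rw [mem_Ico, div_le_iff₀ hn, lt_div_iff₀ hn] at hτ
        rw [Nat.floor_eq_iff (le_trans (by positivity) hτ.1)]
        exact ⟨hτ.1, by simpa using hτ.2⟩
      simp only [hg, h2]
      push_cast
      rfl
  have hlim' : Tendsto (fun n : ℕ => (∑ k ∈ Finset.range ⌈t * (n + 1)⌉₊,
      R (((k + 1) / (n + 1) : ℝ≥0) : ℝ)) / (n + 1)) atTop (𝓝 (∫ τ in (0 : ℝ)..t, R τ)) := by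
    simp only [hsum]
    have hle : ∀ n : ℕ, (t : ℝ) ≤ (⌈t * (n + 1)⌉₊ : ℝ) / (n + 1) := fun n => by
      rw [le_div_iff₀ (by positivity)]
      exact_mod_cast Nat.le_ceil (t * (n + 1) : ℝ≥0)
    have hle' : ∀ n : ℕ, (⌈t * (n + 1)⌉₊ : ℝ) / (n + 1) - t ≤ 1 / ((n : ℝ) + 1) := fun n => by
      have h2 : (⌈t * (n + 1)⌉₊ : ℝ) < t * (n + 1) + 1 := by
        exact_mod_cast Nat.ceil_lt_add_one (zero_le : 0 ≤ (t * (n + 1) : ℝ≥0))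
      have h3 : (0 : ℝ) < n + 1 := by positivity
      rw [sub_le_iff_le_add, div_le_iff₀ h3, add_mul, div_mul_cancel₀ _ h3.ne']
      linarith
    have hdiff : Tendsto (fun n : ℕ => ∫ τ in (t : ℝ)..(⌈t * (n + 1)⌉₊ : ℝ) / (n + 1), g n τ)
        atTop (𝓝 0) := by
      have h4 : Tendsto (fun n : ℕ => C * (1 / ((n : ℝ) + 1))) atTop (𝓝 0) := by
        simpa using (tendsto_one_div_add_atTop_nhds_zero_nat (𝕜 := ℝ)).const_mul C
      refine tendsto_of_tendsto_of_tendsto_of_le_of_le tendsto_const_nhds h4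
        (fun n => (hgt n).integral_nonneg (hle n)) fun n => ?_
      exact ((hgt n).integral_le (hle n)).trans (mul_le_mul_of_nonneg_left (hle' n) hC)
    simpa [IsTraffic.integral_add (hgt _)] using hlim.add hdiff
  exact hlim'.limsup_eq

theorem IsTraffic.comp_add {C : ℝ} {R : ℝ → ℝ} (h : IsTraffic C R) (u : ℝ) : IsTraffic C fun t => R (t + u) :=
  ⟨h.measurable.comp (measurable_add_const u), fun _ => h.nonneg _, fun _ => h.le _⟩

theorem IsTraffic.pathIntegral_shift {C : ℝ} {R : ℝ → ℝ} (h : IsTraffic C R)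
    (hR : IsRightContinuous R) (u t : ℝ≥0) :
    pathIntegral (shift u fun τ => R τ) t = ∫ τ in (u : ℝ)..u + t, R τ := by
  have hR' : IsRightContinuous fun τ => R (τ + u) := fun τ hτ =>
    ContinuousWithinAt.comp (f := fun τ : ℝ => τ + u) (hR (τ + u) (add_nonneg hτ u.coe_nonneg))
      (by fun_prop) fun x (hx : τ ≤ x) => by simpa using hx
  have h1 := (h.comp_add u).pathIntegral_eq hR' t
  rw [intervalIntegral.integral_comp_add_right, zero_add, add_comm (t : ℝ)] at h1
  rw [← h1]
  rfl

theorem IsSchedule.isRightContinuous {C : ℝ} {L x : ℕ → ℝ} (h : IsSchedule C L x)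
    (hx : Tendsto x atTop atTop) : IsRightContinuous (packetStream C L x univ) := by
  intro τ _
  have aux : ∀ b c : ℝ, τ < b → (∀ t ∈ Ico τ b, packetStream C L x univ t = c) →
      ContinuousWithinAt (packetStream C L x univ) (Ici τ) τ := by
    intro b c hb hc
    have h1 : packetStream C L x univ =ᶠ[𝓝[≥] τ] fun _ => c := by
      filter_upwards [Ico_mem_nhdsGE hb] with t ht using hc t ht
    exact continuousWithinAt_const.congr_of_eventuallyEq h1 (hc τ ⟨le_rfl, hb⟩)
  rcases IsSchedule.exists_location (C := C) (L := L) hx τ with h0 | ⟨j, hj⟩ | ⟨j, hj⟩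
  · exact aux _ 0 h0 fun t ht => h.packetStream_before _ ht.2
  · exact aux _ C hj.2 fun t ht => packetStream_of_mem (mem_univ j) ⟨hj.1.trans ht.1, ht.2⟩
  · exact aux _ 0 hj.2 fun t ht => h.packetStream_gap _ ⟨hj.1.trans ht.1, ht.2⟩

/-! ### The maximal ergodic theorem -/

section Maximal

variable {α : Type*}

/-- The maximum of `0` and the first `N` Birkhoff sums. -/
noncomputable def maxBirkhoff (T : α → α) (f : α → ℝ) : ℕ → α → ℝ
  | 0 => fun _ => 0
  | N + 1 => fun x => max 0 (f x + maxBirkhoff T f N (T x))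

variable (T : α → α) (f : α → ℝ)

theorem maxBirkhoff_nonneg (N : ℕ) (x : α) : 0 ≤ maxBirkhoff T f N x := by
  cases N with
  | zero => exact le_rfl
  | succ N => exact le_max_left _ _

theorem maxBirkhoff_le_succ (N : ℕ) (x : α) : maxBirkhoff T f N x ≤ maxBirkhoff T f (N + 1) x := by
  induction N generalizing x with
  | zero => exact le_max_left _ _
  | succ N ih => exact max_le_max le_rfl (add_le_add le_rfl (ih (T x)))

theorem birkhoffSum_le_maxBirkhoff (n : ℕ) (x : α) : birkhoffSum T f n x ≤ maxBirkhoff T f n x := by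
  induction n generalizing x with
  | zero => simp [maxBirkhoff]
  | succ n ih =>
    rw [birkhoffSum_succ']
    exact le_max_of_le_right (add_le_add le_rfl (ih (T x)))

theorem exists_maxBirkhoff_eq (N : ℕ) (x : α) : ∃ n, maxBirkhoff T f N x = birkhoffSum T f n x := by
  induction N generalizing x with
  | zero => exact ⟨0, by simp [maxBirkhoff]⟩
  | succ N ih =>
    rcases max_choice 0 (f x + maxBirkhoff T f N (T x)) with h | h
    · exact ⟨0, by rw [birkhoffSum_zero]; exact h⟩
    · obtain ⟨n, hn⟩ := ih (T x)
      exact ⟨n + 1, by rw [birkhoffSum_succ', ← hn]; exact h⟩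

variable {T f} [MeasurableSpace α] {μ : Measure α}

theorem measurable_maxBirkhoff (hT : Measurable T) (hf : Measurable f) (N : ℕ) :
    Measurable (maxBirkhoff T f N) := by
  induction N with
  | zero => exact measurable_const
  | succ N ih => exact measurable_const.max (hf.add (ih.comp hT))

theorem integrable_maxBirkhoff (hT : MeasurePreserving T μ μ) (hf : Integrable f μ)
    (N : ℕ) : Integrable (maxBirkhoff T f N) μ := by
  induction N with
  | zero => exact integrable_zero _ _ _
  | succ N ih => exact (integrable_zero _ _ _).sup (hf.add (hT.integrable_comp_of_integrable ih))

/-- The maximal ergodic theorem. -/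
theorem setIntegral_birkhoffSum_pos_nonneg (hT : MeasurePreserving T μ μ) (hfm : Measurable f)
    (hf : Integrable f μ) : 0 ≤ ∫ x in {x | ∃ n, 0 < birkhoffSum T f n x}, f x ∂μ := by
  have hmeas : ∀ N, MeasurableSet {x | 0 < maxBirkhoff T f N x} := fun N =>
    measurableSet_lt measurable_const (measurable_maxBirkhoff hT.measurable hfm N)
  have hmono : Monotone fun N => {x | 0 < maxBirkhoff T f N x} :=
    monotone_nat_of_le_succ fun N x hx => lt_of_lt_of_le hx (maxBirkhoff_le_succ T f N x)
  have hset : {x | ∃ n, 0 < birkhoffSum T f n x} = ⋃ N, {x | 0 < maxBirkhoff T f N x} := by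
    ext x
    rw [mem_iUnion]
    constructor
    · rintro ⟨n, hn⟩
      exact ⟨n, lt_of_lt_of_le hn (birkhoffSum_le_maxBirkhoff T f n x)⟩
    · rintro ⟨N, hN⟩
      obtain ⟨n, hn⟩ := exists_maxBirkhoff_eq T f N x
      exact ⟨n, hn ▸ hN⟩
  rw [hset]
  refine ge_of_tendsto' (tendsto_setIntegral_of_monotone hmeas hmono hf.integrableOn) fun N => ?_
  have hM := integrable_maxBirkhoff hT hf N
  have hMT : Integrable (fun x => maxBirkhoff T f N (T x)) μ := hT.integrable_comp_of_integrable hM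
  have h1 : ∫ x, (maxBirkhoff T f N x - maxBirkhoff T f N (T x)) ∂μ = 0 := by
    rw [integral_sub hM hMT, sub_eq_zero]
    have := integral_map (μ := μ) hT.measurable.aemeasurable
      (f := maxBirkhoff T f N) (by rw [hT.map_eq]; exact hM.aestronglyMeasurable)
    rw [hT.map_eq] at this
    exact this
  -- Garsia's argument. Where the maximum is positive, it is at most `f` plus its own value at `T
  -- x`; elsewhere it is zero and hence at most that value. Integrating, the two maxima cancel by
  -- invariance.
  rw [← integral_indicator (hmeas N)]
  refine h1.symm.le.trans (integral_mono (hM.sub hMT) (hf.indicator (hmeas N)) fun x => ?_)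
  by_cases hx : 0 < maxBirkhoff T f N x
  · rw [indicator_of_mem (s := {x | 0 < maxBirkhoff T f N x}) hx]
    cases N with
    | zero => exact absurd hx (lt_irrefl 0)
    | succ N =>
      have h2 : maxBirkhoff T f (N + 1) x = f x + maxBirkhoff T f N (T x) := by
        rcases max_choice 0 (f x + maxBirkhoff T f N (T x)) with h | h
        · exact absurd hx (not_lt.2 (le_of_eq h))
        · exact h
      have h3 := maxBirkhoff_le_succ T f N (T x)
      dsimp only
      linarith
  · rw [indicator_of_notMem (s := {x | 0 < maxBirkhoff T f N x}) hx]
    have := maxBirkhoff_nonneg T f N (T x)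
    dsimp only
    linarith

/-- If sets decrease to a null set, then the visits to them become uniformly rare. -/
theorem ae_exists_birkhoffSum_indicator_le [IsFiniteMeasure μ] (hT : MeasurePreserving T μ μ)
    {Φ : ℕ → Set α} (hΦ : ∀ B, MeasurableSet (Φ B)) (hanti : Antitone Φ)
    (hnull : μ (⋂ B, Φ B) = 0) :
    ∀ᵐ x ∂μ, ∀ l : ℝ, 0 < l → ∃ B, ∀ n,
      birkhoffSum T ((Φ B).indicator fun _ => (1 : ℝ)) n x ≤ l * n := by
  have key : ∀ l : ℝ, 0 < l → ∀ᵐ x ∂μ, ∃ B, ∀ n,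
      birkhoffSum T ((Φ B).indicator fun _ => (1 : ℝ)) n x ≤ l * n := by
    intro l hl
    set f : ℕ → α → ℝ := fun B x => (Φ B).indicator (fun _ => (1 : ℝ)) x - l with hf
    have hfi : ∀ B, Integrable (f B) μ := fun B =>
      ((integrable_const (1 : ℝ)).indicator (hΦ B)).sub (integrable_const l)
    have hfm : ∀ B, Measurable (f B) := fun B =>
      (measurable_const.indicator (hΦ B)).sub_const l
    have hsum : ∀ B n x, birkhoffSum T (f B) n x =
        birkhoffSum T ((Φ B).indicator fun _ => (1 : ℝ)) n x - l * n := by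
      intro B n x
      simp only [birkhoffSum, hf, Finset.sum_sub_distrib, Finset.sum_const, Finset.card_range,
        nsmul_eq_mul]
      ring
    set G : ℕ → Set α := fun B => {x | ∃ n, 0 < birkhoffSum T (f B) n x} with hG
    -- The maximal ergodic theorem for the indicator of `Φ B` minus `l`. As `Φ B` shrinks to a null
    -- set, almost every point lies outside some `G B`.
    have hbound : ∀ B, l * μ.real (G B) ≤ μ.real (Φ B) := by
      intro B
      have h1 := setIntegral_birkhoffSum_pos_nonneg hT (hfm B) (hfi B)
      change 0 ≤ ∫ x in G B, f B x ∂μ at h1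
      simp only [hf] at h1
      rw [integral_sub (((integrable_const (1 : ℝ)).indicator (hΦ B)).integrableOn)
        (integrable_const l), integral_indicator_const (1 : ℝ) (hΦ B), integral_const] at h1
      simp only [smul_eq_mul, mul_one, measureReal_restrict_apply_univ] at h1
      have h2 : (μ.restrict (G B)).real (Φ B) ≤ μ.real (Φ B) := by
        rw [measureReal_restrict_apply (hΦ B)]
        exact measureReal_mono inter_subset_left
      linarith
    have hlim : Tendsto (fun B => μ.real (Φ B) / l) atTop (𝓝 0) := by
      have h1 := tendsto_measure_iInter_atTop (μ := μ)
        (fun B => (hΦ B).nullMeasurableSet) hanti ⟨0, measure_ne_top μ _⟩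
      rw [hnull] at h1
      have h2 := (ENNReal.tendsto_toReal ENNReal.zero_ne_top).comp h1
      simpa [measureReal_def] using h2.div_const l
    have hzero : μ.real (⋂ B, G B) = 0 := by
      refine le_antisymm (ge_of_tendsto' hlim fun B => ?_) measureReal_nonneg
      rw [le_div_iff₀ hl, mul_comm]
      exact (mul_le_mul_of_nonneg_left (measureReal_mono (iInter_subset G B)) hl.le).trans (hbound B)
    rw [measureReal_eq_zero_iff] at hzero
    filter_upwards [measure_eq_zero_iff_ae_notMem.1 hzero] with x hx
    rw [mem_iInter, not_forall] at hx
    obtain ⟨B, hB⟩ := hx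
    refine ⟨B, fun n => ?_⟩
    by_contra hcon
    exact hB ⟨n, by rw [hsum]; linarith [not_le.1 hcon]⟩
  have hall : ∀ᵐ x ∂μ, ∀ m : ℕ, ∃ B, ∀ n,
      birkhoffSum T ((Φ B).indicator fun _ => (1 : ℝ)) n x ≤ 1 / ((m : ℝ) + 1) * n :=
    ae_all_iff.2 fun m => key _ (by positivity)
  filter_upwards [hall] with x hx l hl
  obtain ⟨m, hm⟩ := exists_nat_one_div_lt hl
  obtain ⟨B, hB⟩ := hx m
  exact ⟨B, fun n => (hB n).trans (mul_le_mul_of_nonneg_right hm.le (Nat.cast_nonneg n))⟩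

end Maximal

/-! ### Criteria for long excursions to be rare -/

theorem measureReal_le_of_floor_mem {A : Set ℝ} {h : ℝ} (hh : 0 < h) (S : Finset ℕ)
    (hA : ∀ τ ∈ A, 0 ≤ τ ∧ ⌊τ / h⌋₊ ∈ S) : volume.real A ≤ h * S.card := by
  have hsub : A ⊆ ⋃ n ∈ S, Icc (n * h) ((n + 1) * h) := by
    intro τ hτ
    obtain ⟨h0, hmem⟩ := hA τ hτ
    refine mem_biUnion hmem ⟨?_, ?_⟩
    · rw [← le_div_iff₀ hh]; exact Nat.floor_le (by positivity)
    · rw [← div_le_iff₀ hh]; exact (Nat.lt_floor_add_one _).le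
  have hfin : volume (⋃ n ∈ S, Icc ((n : ℝ) * h) ((n + 1) * h)) ≠ ⊤ :=
    ((measure_biUnion_lt_top S.finite_toSet fun n _ => measure_Icc_lt_top)).ne
  refine (measureReal_mono hsub hfin).trans ((measureReal_biUnion_finset_le _ _).trans ?_)
  have : ∀ n ∈ S, volume.real (Icc ((n : ℝ) * h) ((n + 1) * h)) = h := fun n _ => by
    rw [Real.volume_real_Icc_of_le (by nlinarith)]; ring
  rw [Finset.sum_congr rfl this, Finset.sum_const, nsmul_eq_mul, mul_comm]

open Classical in
/-- A one-sided maximal inequality for sequences. -/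
theorem mul_card_le_sum {a : ℕ → ℝ} (ha : ∀ k, 0 ≤ a k) {β : ℝ} (hβ : 0 ≤ β) (N : ℕ) :
    β * ((Finset.range N).filter fun n => ∃ m ≤ n,
      β * (n + 1 - m) ≤ ∑ k ∈ Finset.Ico m (n + 1), a k).card ≤ ∑ k ∈ Finset.range N, a k := by
  induction N using Nat.strong_induction_on with
  | _ N ih =>
    rcases N with _ | N
    · simp
    -- If the last index is marked, its window `[m, N]` has enough mass to pay for all indices in
    -- it, marked or not, and the induction resumes at `m`.
    by_cases hN : ∃ m ≤ N, β * (N + 1 - m) ≤ ∑ k ∈ Finset.Ico m (N + 1), a k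
    · obtain ⟨m, hm, hle⟩ := hN
      have h1 := ih m (by omega)
      have h2 : ((Finset.range (N + 1)).filter fun n => ∃ m ≤ n,
          β * (n + 1 - m) ≤ ∑ k ∈ Finset.Ico m (n + 1), a k) ⊆
          ((Finset.range m).filter fun n => ∃ m ≤ n,
            β * (n + 1 - m) ≤ ∑ k ∈ Finset.Ico m (n + 1), a k) ∪ Finset.Ico m (N + 1) := by
        intro n hn
        rw [Finset.mem_filter, Finset.mem_range] at hn
        rw [Finset.mem_union, Finset.mem_filter, Finset.mem_range, Finset.mem_Ico]
        rcases lt_or_ge n m with hnm | hnm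
        · exact Or.inl ⟨hnm, hn.2⟩
        · exact Or.inr ⟨hnm, hn.1⟩
      have h3 := (Finset.card_le_card h2).trans (Finset.card_union_le _ _)
      rw [Nat.card_Ico] at h3
      have h4 : (((Finset.range (N + 1)).filter fun n => ∃ m ≤ n,
          β * (n + 1 - m) ≤ ∑ k ∈ Finset.Ico m (n + 1), a k).card : ℝ) ≤
          (((Finset.range m).filter fun n => ∃ m ≤ n,
            β * (n + 1 - m) ≤ ∑ k ∈ Finset.Ico m (n + 1), a k).card : ℝ) + (N + 1 - m) := by
        have h5 : ((N + 1 - m : ℕ) : ℝ) = N + 1 - m := by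
          rw [Nat.cast_sub (by omega)]; push_cast; ring
        rw [← h5]
        exact_mod_cast h3
      rw [← Finset.sum_range_add_sum_Ico a (by omega : m ≤ N + 1)]
      have h6 := mul_le_mul_of_nonneg_left h4 hβ
      linarith
    · rw [Finset.range_add_one, Finset.filter_insert, if_neg hN, ← Finset.range_add_one,
        Finset.sum_range_succ]
      exact (ih N (by omega)).trans (le_add_of_nonneg_right (ha N))

/-- The net input, at service rate `ρ`, between the times `a` and `b`. -/
noncomputable def netInput (ρ : ℝ) (R : ℝ → ℝ) (a b : ℝ) : ℝ := (∫ τ in a..b, R τ) - ρ * (b - a)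

section Criteria

variable {C ρ : ℝ} {R : ℝ → ℝ}

theorem IsTraffic.netInput_add (h : IsTraffic C R) (a b c : ℝ) :
    netInput ρ R a b + netInput ρ R b c = netInput ρ R a c := by
  unfold netInput
  rw [← h.integral_add a b c]; ring

theorem IsTraffic.netInput_le (h : IsTraffic C R) (hρ : 0 ≤ ρ) {a b : ℝ} (hab : a ≤ b) :
    netInput ρ R a b ≤ C * (b - a) := by
  have h1 := h.integral_le hab
  have h2 : 0 ≤ ρ * (b - a) := mul_nonneg hρ (by linarith)
  unfold netInput; linarith

theorem IsTraffic.neg_le_netInput (h : IsTraffic C R) {a b : ℝ} (hab : a ≤ b) :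
    -(ρ * (b - a)) ≤ netInput ρ R a b := by
  have h1 := h.integral_nonneg hab
  unfold netInput; linarith

open Classical in
/-- Long excursions are rare if, at a lower service rate, the net input after most times is
bounded. -/
theorem rareLongExcursions_of_drift (h : IsTraffic C R) {ρ' c : ℝ} (hρ' : 0 ≤ ρ') (hlt : ρ' < ρ)
    (hC : ρ < C) (hc : 0 < c)
    (hfreq : ∀ l : ℝ, 0 < l → ∃ B : ℕ, ∀ N : ℕ, (((Finset.range N).filter fun k : ℕ =>
      ∃ q : ℕ, (B : ℝ) < netInput ρ' R k (k + q)).card : ℝ) ≤ l * N) :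
    RareLongExcursions (workload ρ R) c := by
  intro η hη
  have hC0 : 0 < C := by linarith
  -- Even at full rate `C`, the first fraction `κ` of an excursion carries at most half of the
  -- surplus `(ρ - ρ') d`.
  set κ := (ρ - ρ') / (2 * C) with hκ
  have hκ0 : 0 < κ := div_pos (by linarith) (by linarith)
  have hκC : C * κ = (ρ - ρ') / 2 := by rw [hκ]; field_simp
  have hκ1 : κ ≤ 1 / 2 := by
    rw [hκ, div_le_iff₀ (by linarith)]; linarith
  obtain ⟨B, hB⟩ := hfreq (η / 2 * (κ / 4)) (by positivity)
  set K := max (2 / κ) (2 * (B + ρ') / (ρ - ρ')) with hK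
  have hK2 : 2 / κ ≤ K := le_max_left _ _
  have hKκ : 2 ≤ κ * K := by rw [div_le_iff₀ hκ0] at hK2; linarith
  have hK1 : 2 ≤ K := by nlinarith
  have hKB : 2 * (B + ρ') ≤ (ρ - ρ') * K := by
    have : 2 * (B + ρ') / (ρ - ρ') ≤ K := le_max_right _ _
    rw [div_le_iff₀ (by linarith)] at this; linarith
  refine ⟨K, by linarith, ?_⟩
  filter_upwards [eventually_ge_atTop 1] with t ht
  set a : ℕ → ℝ := fun k => if ∃ q : ℕ, (B : ℝ) < netInput ρ' R k (k + q) then 1 else 0 with ha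
  set N := ⌊t⌋₊ + 1 with hN
  have hmem : ∀ τ ∈ longExcursion (workload ρ R) c K t, 0 ≤ τ ∧
      ⌊τ / 1⌋₊ ∈ (Finset.range N).filter fun n => ∃ m ≤ n,
        κ / 4 * (n + 1 - m) ≤ ∑ k ∈ Finset.Ico m (n + 1), a k := by
    rintro τ ⟨hτ, hexc⟩
    refine ⟨hτ.1, ?_⟩
    rw [div_one, Finset.mem_filter, Finset.mem_range]
    refine ⟨Nat.lt_succ_of_le (Nat.floor_le_floor hτ.2), ?_⟩
    obtain ⟨x, hx, hWx⟩ := h.exists_workload_eq (ρ := ρ) hτ.1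
    -- At a maximizing start `x` the workload vanishes, so `x` cannot lie in the stretch where it is
    -- at least `c > 0`.
    have hxK : x < τ - K := by
      by_contra hcon
      have h1 := hexc x hx (not_lt.1 hcon)
      have h2 := h.workload_add_le (ρ := ρ) hx.1 hx.2
      linarith
    have hdrift : ρ * (τ - x) ≤ ∫ y in x..τ, R y := by
      have := h.workload_nonneg (ρ := ρ) hτ.1
      linarith
    set d := τ - x with hd
    have hxκ : x + κ * d ≤ τ := by nlinarith
    have hκd : 2 ≤ κ * d := hKκ.trans (mul_le_mul_of_nonneg_left (by linarith) hκ0.le)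
    have hfloor : (⌊τ⌋₊ : ℝ) ≤ τ := Nat.floor_le hτ.1
    have hceil : (⌈x⌉₊ : ℝ) < x + 1 := Nat.ceil_lt_add_one hx.1
    refine ⟨⌈x⌉₊, Nat.le_floor (by linarith), ?_⟩
    -- From each such `k` to the next grid point after `τ`, the net input at rate `ρ'` is at least
    -- `(ρ - ρ') d / 2 - ρ'`, which exceeds `B` by the choice of `K`.
    have hone : ∀ k ∈ Finset.Ico ⌈x⌉₊ (⌊x + κ * d⌋₊ + 1), a k = 1 := by
      intro k hk
      rw [Finset.mem_Ico] at hk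
      have hk1 : x ≤ k := Nat.ceil_le.1 hk.1
      have hk2 : (k : ℝ) ≤ x + κ * d :=
        (Nat.le_floor_iff (by nlinarith [hx.1])).1 (Nat.lt_succ_iff.1 hk.2)
      refine if_pos ⟨⌈τ - k⌉₊, ?_⟩
      have h1 : τ - k ≤ (⌈τ - k⌉₊ : ℝ) := Nat.le_ceil _
      have h2 : (⌈τ - k⌉₊ : ℝ) < τ - k + 1 := Nat.ceil_lt_add_one (by linarith)
      have h3 := h.netInput_add (ρ := ρ') k τ (k + ⌈τ - k⌉₊)
      have h4 := h.neg_le_netInput (ρ := ρ') (by linarith : τ ≤ k + ⌈τ - k⌉₊)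
      have h5 : ρ' * (k + ⌈τ - k⌉₊ - τ) ≤ ρ' := by nlinarith
      have h6 := h.integral_add x k τ
      have h7 := h.integral_le hk1
      have h8 : C * (k - x) ≤ (ρ - ρ') / 2 * d := by
        rw [← hκC, mul_assoc]; exact mul_le_mul_of_nonneg_left (by linarith) hC0.le
      have h9 : ρ' * (τ - k) ≤ ρ' * d := mul_le_mul_of_nonneg_left (by linarith) hρ'
      have h10 : (ρ - ρ') * K < (ρ - ρ') * d := mul_lt_mul_of_pos_left (by linarith) (by linarith)
      have h11 : netInput ρ' R k τ = (∫ y in (k : ℝ)..τ, R y) - ρ' * (τ - k) := rfl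
      linarith
    have hsub : Finset.Ico ⌈x⌉₊ (⌊x + κ * d⌋₊ + 1) ⊆ Finset.Ico ⌈x⌉₊ (⌊τ⌋₊ + 1) :=
      Finset.Ico_subset_Ico le_rfl (by have := Nat.floor_le_floor hxκ; omega)
    have h1 : ∑ k ∈ Finset.Ico ⌈x⌉₊ (⌊x + κ * d⌋₊ + 1), a k ≤
        ∑ k ∈ Finset.Ico ⌈x⌉₊ (⌊τ⌋₊ + 1), a k :=
      Finset.sum_le_sum_of_subset_of_nonneg hsub fun k _ _ => by
        simp only [ha]; split_ifs <;> norm_num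
    rw [Finset.sum_congr rfl hone, Finset.sum_const, Nat.card_Ico, nsmul_eq_mul, mul_one] at h1
    have h2 : (⌊x + κ * d⌋₊ : ℝ) + 1 - ⌈x⌉₊ ≤ ((⌊x + κ * d⌋₊ + 1 - ⌈x⌉₊ : ℕ) : ℝ) := by
      rw [sub_le_iff_le_add]
      have : ⌊x + κ * d⌋₊ + 1 ≤ (⌊x + κ * d⌋₊ + 1 - ⌈x⌉₊) + ⌈x⌉₊ := by omega
      exact_mod_cast this
    have h3 : x + κ * d < ⌊x + κ * d⌋₊ + 1 := Nat.lt_floor_add_one _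
    have h4 : x ≤ ⌈x⌉₊ := Nat.le_ceil _
    have h5 : κ / 4 * (⌊τ⌋₊ + 1 - ⌈x⌉₊) ≤ κ / 4 * (2 * d) :=
      mul_le_mul_of_nonneg_left (by linarith) (by positivity)
    linarith
  have h1 := measureReal_le_of_floor_mem one_pos _ hmem
  have h2 := mul_card_le_sum (a := a) (fun k => by simp only [ha]; split_ifs <;> norm_num)
    (β := κ / 4) (by positivity) N
  have h3 := hB N
  have h4 : ∑ k ∈ Finset.range N, a k = (((Finset.range N).filter fun k : ℕ =>
      ∃ q : ℕ, (B : ℝ) < netInput ρ' R k (k + q)).card : ℝ) := by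
    simp [ha]
  rw [h4] at h2
  rw [one_mul] at h1
  have h5 : (N : ℝ) ≤ 2 * t := by
    have : (⌊t⌋₊ : ℝ) ≤ t := Nat.floor_le (by linarith)
    rw [hN]; push_cast; linarith
  have h6 : η / 2 * (κ / 4) * N ≤ η / 2 * (κ / 4) * (2 * t) :=
    mul_le_mul_of_nonneg_left h5 (by positivity)
  have h7 := mul_le_mul_of_nonneg_left h1 (by positivity : 0 ≤ κ / 4)
  have h8 : κ / 4 * volume.real (longExcursion (workload ρ R) c K t) ≤ κ / 4 * (η * t) := by
    linarith
  exact le_of_mul_le_mul_left h8 (by positivity)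

open Classical in
/-- Long excursions are rare if the net input is bounded by `b` and, after most times, comes close
to `b` soon. -/
theorem rareLongExcursions_of_bounded (h : IsTraffic C R) (hρ : 0 ≤ ρ) {b c s : ℝ} (hc : 0 < c)
    (hs : 0 < s) (hCs : C * s ≤ c / 4)
    (hbdd : ∀ q r : ℕ, netInput ρ R (s * q) (s * (q + r)) ≤ b)
    (hfreq : ∀ l : ℝ, 0 < l → ∃ K : ℕ, ∀ N : ℕ, (((Finset.range N).filter fun k : ℕ =>
      ∀ q ≤ K, ∀ r : ℕ, netInput ρ R (s * (k + q)) (s * (k + q + r)) ≤ b - c / 2).card : ℝ) ≤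
        l * N) :
    RareLongExcursions (workload ρ R) c := by
  intro η hη
  obtain ⟨K, hK⟩ := hfreq (η / 2) (half_pos hη)
  refine ⟨s * (K + 1), by positivity, ?_⟩
  filter_upwards [eventually_ge_atTop s] with t ht
  set N := ⌊t / s⌋₊ + 1 with hN
  set F := (Finset.range N).filter fun k : ℕ =>
      ∀ q ≤ K, ∀ r : ℕ, netInput ρ R (s * (k + q)) (s * (k + q + r)) ≤ b - c / 2 with hF
  have hmem : ∀ τ ∈ longExcursion (workload ρ R) c (s * (K + 1)) t, 0 ≤ τ ∧
      ⌊τ / s⌋₊ ∈ F.image (· + K) := by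
    rintro τ ⟨hτ, hexc⟩
    refine ⟨hτ.1, ?_⟩
    have hfl : (⌊τ / s⌋₊ : ℝ) * s ≤ τ := by
      rw [← le_div_iff₀ hs]; exact Nat.floor_le (div_nonneg hτ.1 hs.le)
    have hfl' : τ < (⌊τ / s⌋₊ + 1 : ℝ) * s := by
      rw [← div_lt_iff₀ hs]; exact Nat.lt_floor_add_one _
    have hKn : K ≤ ⌊τ / s⌋₊ := by
      by_contra hcon
      have h1 : (⌊τ / s⌋₊ : ℝ) ≤ K := by exact_mod_cast (not_le.1 hcon).le
      have h2 := hexc 0 ⟨le_rfl, hτ.1⟩ (by nlinarith)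
      rw [h.workload_zero] at h2
      linarith
    obtain ⟨k, hk⟩ := Nat.exists_eq_add_of_le' hKn
    rw [Finset.mem_image]
    refine ⟨k, ?_, hk.symm⟩
    rw [hF, Finset.mem_filter, Finset.mem_range]
    refine ⟨?_, ?_⟩
    · have : ⌊τ / s⌋₊ ≤ ⌊t / s⌋₊ := Nat.floor_le_floor (div_le_div_of_nonneg_right hτ.2 hs.le)
      omega
    -- A workload of at least `c` at `s (k + q)` means net input at least `c` since some `x`.
    -- Rounding `x` up to the grid loses at most `c / 4`, so appending a net input above `b - c / 2`
    -- would exceed the bound `b`.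
    by_contra hcon
    push Not at hcon
    obtain ⟨q, hq, r, hqr⟩ := hcon
    have hq' : (q : ℝ) ≤ K := by exact_mod_cast hq
    have hkK : (⌊τ / s⌋₊ : ℝ) = k + K := by rw [hk]; push_cast; ring
    rw [hkK] at hfl hfl'
    have hu0 : (0 : ℝ) ≤ s * (k + q) := by positivity
    have huτ : s * (k + q) ≤ τ := by nlinarith
    have hW := hexc (s * (k + q)) ⟨hu0, huτ⟩ (by nlinarith [(Nat.cast_nonneg q : (0 : ℝ) ≤ q)])
    obtain ⟨x, hx, hWx⟩ := h.exists_workload_eq (ρ := ρ) hu0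
    have hWx' : workload ρ R (s * (k + q)) = netInput ρ R x (s * (k + q)) := hWx
    have hx0 : 0 ≤ x / s := div_nonneg hx.1 hs.le
    have hm1 : x ≤ s * ⌈x / s⌉₊ := by
      rw [mul_comm, ← div_le_iff₀ hs]; exact Nat.le_ceil _
    have hm2 : s * ⌈x / s⌉₊ ≤ x + s := by
      have h1 : (⌈x / s⌉₊ : ℝ) ≤ x / s + 1 := (Nat.ceil_lt_add_one hx0).le
      calc s * (⌈x / s⌉₊ : ℝ) ≤ s * (x / s + 1) := mul_le_mul_of_nonneg_left h1 hs.le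
        _ = x + s := by field_simp
    have hm3 : ⌈x / s⌉₊ ≤ k + q := by
      refine Nat.ceil_le.2 ?_
      rw [div_le_iff₀ hs]; push_cast; linarith [hx.2]
    obtain ⟨r', hr'⟩ := Nat.exists_eq_add_of_le hm3
    have hr'' : (k : ℝ) + q = ⌈x / s⌉₊ + r' := by exact_mod_cast hr'
    have h1 := h.netInput_le hρ hm1
    have h2 : C * (s * ⌈x / s⌉₊ - x) ≤ C * s :=
      mul_le_mul_of_nonneg_left (by linarith) ((h.nonneg 0).trans (h.le 0))
    have h3 := hbdd ⌈x / s⌉₊ (r' + r)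
    have h4 : s * ((⌈x / s⌉₊ : ℝ) + ((r' + r : ℕ) : ℝ)) = s * (k + q + r) := by
      rw [hr'']; push_cast; ring
    rw [h4] at h3
    have h5 := h.netInput_add (ρ := ρ) x (s * ⌈x / s⌉₊) (s * (k + q))
    have h6 := h.netInput_add (ρ := ρ) (s * ⌈x / s⌉₊) (s * (k + q)) (s * (k + q + r))
    linarith
  have h1 := measureReal_le_of_floor_mem hs _ hmem
  have h2 : ((F.image (· + K)).card : ℝ) ≤ F.card := by exact_mod_cast Finset.card_image_le
  have h3 := hK N
  have h4 : s * (N : ℝ) ≤ 2 * t := by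
    have : (⌊t / s⌋₊ : ℝ) ≤ t / s := Nat.floor_le (div_nonneg (hs.le.trans ht) hs.le)
    rw [le_div_iff₀ hs] at this
    rw [hN]; push_cast; linarith
  have h5 := mul_le_mul_of_nonneg_left (h2.trans h3) hs.le
  have h6 := mul_le_mul_of_nonneg_left h4 (half_pos hη).le
  linarith

/-- The long-term rate from affine bounds along the integers. -/
theorem hasLongTermRate_of_bounds (h : IsTraffic C R) {r : ℝ}
    (hr : ∀ ε : ℝ, 0 < ε → ∃ B : ℝ, ∀ n : ℕ, |(∫ τ in (0 : ℝ)..n, R τ) - r * n| ≤ ε * n + B) :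
    HasLongTermRate R r := by
  intro s hs
  rw [Metric.tendsto_atTop]
  intro ε hε
  obtain ⟨B, hB⟩ := hr (ε / 2) (half_pos hε)
  set D := |B| + C + |r| + C * s + |r| * s with hD
  have hC : 0 ≤ C := (h.nonneg 0).trans (h.le 0)
  have hD0 : 0 ≤ D := by positivity
  refine ⟨max (s + 1) (2 * (D + ε * s + 1) / ε), fun t ht => ?_⟩
  have hts : s + 1 ≤ t := (le_max_left _ _).trans ht
  have htD : 2 * (D + ε * s + 1) ≤ t * ε := by
    rw [← div_le_iff₀ hε]; exact (le_max_right _ _).trans ht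
  have hpos : 0 < t - s := by linarith
  have ht0 : 0 ≤ t := by linarith
  have hfl : (⌊t⌋₊ : ℝ) ≤ t := Nat.floor_le ht0
  have hfl' : t < ⌊t⌋₊ + 1 := Nat.lt_floor_add_one t
  have h1 := abs_le.1 (hB ⌊t⌋₊)
  have h2 := h.integral_add 0 ⌊t⌋₊ t
  have h3 := h.integral_nonneg hfl
  have h4 := h.integral_le hfl
  have h4' : C * (t - ⌊t⌋₊) ≤ C := by nlinarith
  have h5 := h.integral_add 0 s t
  have h6 := h.integral_nonneg hs
  have h7 := h.integral_le hs
  have h8 : |r * (t - ⌊t⌋₊)| ≤ |r| := by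
    rw [abs_mul, abs_of_nonneg (by linarith : 0 ≤ t - (⌊t⌋₊ : ℝ))]
    exact mul_le_of_le_one_right (abs_nonneg r) (by linarith)
  have h9 : |r * s| = |r| * s := by rw [abs_mul, abs_of_nonneg hs]
  have h8' := abs_le.1 h8
  have h9' := abs_le.1 h9.le
  have h10 := le_abs_self B
  have h11 : ε / 2 * ⌊t⌋₊ ≤ ε / 2 * t := mul_le_mul_of_nonneg_left hfl (half_pos hε).le
  have key : |(∫ τ in s..t, R τ) - r * (t - s)| < ε * (t - s) := by
    rw [abs_lt]
    constructor <;> nlinarith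
  rw [Real.dist_eq]
  have h12 : (∫ τ in s..t, R τ) / (t - s) - r = ((∫ τ in s..t, R τ) - r * (t - s)) / (t - s) := by
    field_simp
  rw [h12, abs_div, abs_of_pos hpos, div_lt_iff₀ hpos]
  exact key

end Criteria

/-! ### Stationary ergodic traffic -/

section Stationary

variable {Ω : Type*} [MeasurableSpace Ω] {P : Measure Ω} {C ρ : ℝ} {R : Ω → ℝ → ℝ}

theorem IsStationary.aemeasurable (h : IsStationary P fun (t : ℝ≥0) ω => R ω t) :
    AEMeasurable (fun ω (t : ℝ≥0) => R ω t) P := (h 0).aemeasurable_snd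

theorem IsStationary.measurePreserving_shift (h : IsStationary P fun (t : ℝ≥0) ω => R ω t)
    (u : ℝ≥0) : MeasurePreserving (shift u) (P.map fun ω (t : ℝ≥0) => R ω t)
      (P.map fun ω (t : ℝ≥0) => R ω t) := by
  refine ⟨measurable_shift u, ?_⟩
  rw [AEMeasurable.map_map_of_aemeasurable (measurable_shift u).aemeasurable h.aemeasurable]
  exact (h u).map_eq

/-- The accumulated traffic minus `c` times the elapsed time, as a functional of the path. -/
noncomputable def pathNetInput (c : ℝ) (x : ℝ≥0 → ℝ) (t : ℝ≥0) : ℝ := pathIntegral x t - c * t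

theorem measurable_pathNetInput (c : ℝ) (t : ℝ≥0) : Measurable fun x => pathNetInput c x t :=
  (measurable_pathIntegral t).sub_const _

theorem IsTraffic.pathNetInput_shift {R : ℝ → ℝ} (h : IsTraffic C R) (hR : IsRightContinuous R)
    (c : ℝ) (u t : ℝ≥0) :
    pathNetInput c (shift u fun τ => R τ) t = netInput c R u (u + t) := by
  rw [pathNetInput, h.pathIntegral_shift hR, netInput, add_sub_cancel_left]

theorem shift_zero (x : ℝ≥0 → ℝ) : shift 0 x = x := by funext t; simp [shift]

theorem IsTraffic.pathNetInput_eq {R : ℝ → ℝ} (h : IsTraffic C R) (hR : IsRightContinuous R)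
    (c : ℝ) (t : ℝ≥0) : pathNetInput c (fun τ => R τ) t = netInput c R 0 t := by
  have := h.pathNetInput_shift hR c 0 t
  rwa [shift_zero, NNReal.coe_zero, zero_add] at this

theorem birkhoffSum_netInput {R : ℝ → ℝ} (h : IsTraffic C R) (hR : IsRightContinuous R)
    (a c : ℝ) (n : ℕ) :
    birkhoffSum (shift 1) (fun x => a * pathNetInput c x 1) n (fun τ => R τ) =
      a * netInput c R 0 n := by
  induction n with
  | zero => simp [netInput]
  | succ n ih =>
    have h1 := h.pathNetInput_shift hR c (n * 1) 1
    simp only [mul_one, NNReal.coe_natCast, NNReal.coe_one] at h1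
    have h2 := h.netInput_add (ρ := c) 0 n (n + 1)
    rw [birkhoffSum_succ, ih, iterate_shift, mul_one, h1, ← mul_add, h2]
    push_cast; rfl

/-- The two windows differ by pieces of length `u` at either end. This makes unboundedness along the
integers invariant under all real shifts. -/
theorem abs_netInput_shift_sub_le {R : ℝ → ℝ} (h : IsTraffic C R) (a c : ℝ) {u : ℝ} (hu : 0 ≤ u)
    (n : ℕ) : |a * netInput c R u (u + n) - a * netInput c R 0 n| ≤ |a| * (C * u) := by
  rw [← mul_sub, abs_mul]
  refine mul_le_mul_of_nonneg_left ?_ (abs_nonneg a)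
  have h1 := h.integral_add 0 u (u + n)
  have h2 := h.integral_add 0 n (u + n)
  have h3 := h.integral_nonneg hu
  have h4 := h.integral_le hu
  have h5 := h.integral_nonneg (by linarith : (n : ℝ) ≤ u + n)
  have h6 := h.integral_le (by linarith : (n : ℝ) ≤ u + n)
  unfold netInput
  rw [abs_le]
  constructor <;> linarith

theorem unbounded_of_abs_sub_le {F G : ℕ → ℝ} {D : ℝ} (hD : ∀ n, |F n - G n| ≤ D)
    (hF : ∀ B : ℕ, ∃ n, (B : ℝ) < F n) (B : ℕ) : ∃ n, (B : ℝ) < G n := by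
  obtain ⟨n, hn⟩ := hF (B + ⌈D⌉₊)
  have h1 := (abs_le.1 (hD n)).2
  have h2 := Nat.le_ceil D
  push_cast at hn
  exact ⟨n, by linarith⟩

theorem measurableSet_unbounded {α : Type*} [MeasurableSpace α] {F : ℕ → α → ℝ}
    (hF : ∀ n, Measurable (F n)) : MeasurableSet {x | ∀ B : ℕ, ∃ n, (B : ℝ) < F n x} := by
  have : {x | ∀ B : ℕ, ∃ n, (B : ℝ) < F n x} = ⋂ B : ℕ, ⋃ n, {x | (B : ℝ) < F n x} := by
    ext x; simp
  rw [this]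
  exact MeasurableSet.iInter fun B => MeasurableSet.iUnion fun n =>
    measurableSet_lt measurable_const (hF n)

variable [IsProbabilityMeasure P]

theorem integrable_pathNetInput (hreg : ∀ᵐ ω ∂P, IsTraffic C (R ω) ∧ IsRightContinuous (R ω))
    (hstat : IsStationary P fun (t : ℝ≥0) ω => R ω t) (c : ℝ) :
    Integrable (fun x => pathNetInput c x 1) (P.map fun ω (t : ℝ≥0) => R ω t) := by
  have : IsProbabilityMeasure (P.map fun ω (t : ℝ≥0) => R ω t) :=
    Measure.isProbabilityMeasure_map hstat.aemeasurable
  refine Integrable.of_bound (measurable_pathNetInput c 1).aestronglyMeasurable (C + |c|) ?_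
  refine (ae_map_iff hstat.aemeasurable
    (measurableSet_le (measurable_pathNetInput c 1).norm measurable_const)).2 ?_
  filter_upwards [hreg] with ω hω
  rw [hω.1.pathNetInput_eq hω.2, netInput, Real.norm_eq_abs, abs_le]
  have h1 := hω.1.integral_nonneg (zero_le_one' ℝ)
  have h2 := hω.1.integral_le (zero_le_one' ℝ)
  have h3 := abs_le.1 (le_refl |c|)
  simp only [NNReal.coe_one]
  constructor <;> linarith

/-- The mean traffic per unit of time. -/
noncomputable def meanRate (P : Measure Ω) (R : Ω → ℝ → ℝ) : ℝ :=
  ∫ x, pathIntegral x 1 ∂(P.map fun ω (t : ℝ≥0) => R ω t)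

/-- Unboundedness is an invariant event. If it were almost sure, some Birkhoff sum would be positive
almost everywhere, and the maximal ergodic theorem would make the mean drift nonnegative. The factor
`a` allows both signs. -/
theorem ae_bounded_of_drift (hreg : ∀ᵐ ω ∂P, IsTraffic C (R ω) ∧ IsRightContinuous (R ω))
    (hstat : IsStationary P fun (t : ℝ≥0) ω => R ω t)
    (herg : IsErgodic P fun (t : ℝ≥0) ω => R ω t) {a c : ℝ} (hac : a * (meanRate P R - c) < 0) :
    ∀ᵐ ω ∂P, ∃ B : ℕ, ∀ n : ℕ, a * netInput c (R ω) 0 n ≤ B := by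
  have hY := hstat.aemeasurable
  have : IsProbabilityMeasure (P.map fun ω (t : ℝ≥0) => R ω t) :=
    Measure.isProbabilityMeasure_map hY
  set E : Set (ℝ≥0 → ℝ) := {x | ∀ B : ℕ, ∃ n : ℕ, (B : ℝ) < a * pathNetInput c x n} with hE
  have hEm : MeasurableSet E :=
    measurableSet_unbounded fun n : ℕ => (measurable_pathNetInput c n).const_mul a
  have hmem : ∀ ω, IsTraffic C (R ω) ∧ IsRightContinuous (R ω) → ∀ u : ℝ≥0,
      ((fun t : ℝ≥0 => R ω ((t + u : ℝ≥0) : ℝ)) ∈ E ↔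
        ∀ B : ℕ, ∃ n : ℕ, (B : ℝ) < a * netInput c (R ω) u (u + n)) := by
    intro ω hω u
    have h1 := fun n : ℕ => hω.1.pathNetInput_shift hω.2 c u n
    simp only [NNReal.coe_natCast] at h1
    simp only [← h1]
    rfl
  have hmem0 : ∀ ω, IsTraffic C (R ω) ∧ IsRightContinuous (R ω) →
      ((fun t : ℝ≥0 => R ω t) ∈ E ↔ ∀ B : ℕ, ∃ n : ℕ, (B : ℝ) < a * netInput c (R ω) 0 n) := by
    intro ω hω
    simpa using hmem ω hω 0
  have hinv : ∀ u : ℝ≥0, ∀ᵐ ω ∂P, (fun t : ℝ≥0 => R ω ((t + u : ℝ≥0) : ℝ)) ∈ E ↔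
      (fun t : ℝ≥0 => R ω t) ∈ E := by
    intro u
    filter_upwards [hreg] with ω hω
    rw [hmem ω hω, hmem0 ω hω]
    exact ⟨unbounded_of_abs_sub_le fun n => abs_netInput_shift_sub_le hω.1 a c u.coe_nonneg n,
      unbounded_of_abs_sub_le fun n => by
        rw [abs_sub_comm]; exact abs_netInput_shift_sub_le hω.1 a c u.coe_nonneg n⟩
  rcases herg E hEm hinv with h1 | h1
  · exfalso
    have hfm : Measurable fun x => a * pathNetInput c x 1 :=
      (measurable_pathNetInput c 1).const_mul a
    have hfi := (integrable_pathNetInput hreg hstat c).const_mul a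
    have h2 := setIntegral_birkhoffSum_pos_nonneg (hstat.measurePreserving_shift 1) hfm hfi
    have hSm : ∀ n, Measurable (birkhoffSum (shift 1) (fun x => a * pathNetInput c x 1) n) := by
      intro n
      unfold birkhoffSum
      exact Finset.measurable_sum _ fun k _ => hfm.comp ((measurable_shift 1).iterate k)
    have h3 : ∀ᵐ x ∂(P.map fun ω (t : ℝ≥0) => R ω t),
        ∃ n, 0 < birkhoffSum (shift 1) (fun x => a * pathNetInput c x 1) n x := by
      refine (ae_map_iff hY ?_).2 ?_
      · have : {x | ∃ n, 0 < birkhoffSum (shift 1) (fun x => a * pathNetInput c x 1) n x} =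
            ⋃ n, {x | 0 < birkhoffSum (shift 1) (fun x => a * pathNetInput c x 1) n x} := by
          ext x; simp
        rw [this]
        exact MeasurableSet.iUnion fun n => measurableSet_lt measurable_const (hSm n)
      · filter_upwards [h1, hreg] with ω hω hω'
        obtain ⟨n, hn⟩ := (hmem0 ω hω').1 hω 0
        exact ⟨n, by rw [birkhoffSum_netInput hω'.1 hω'.2]; simpa using hn⟩
    have h4 : {x | ∃ n, 0 < birkhoffSum (shift 1) (fun x => a * pathNetInput c x 1) n x}
        =ᵐ[P.map fun ω (t : ℝ≥0) => R ω t] univ := eventuallyEq_univ.2 h3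
    rw [setIntegral_congr_set h4, setIntegral_univ, integral_const_mul] at h2
    have h5 : ∫ x, pathNetInput c x 1 ∂(P.map fun ω (t : ℝ≥0) => R ω t) = meanRate P R - c := by
      have h6 := integrable_pathNetInput hreg hstat 0
      simp only [pathNetInput, zero_mul, sub_zero] at h6
      simp only [pathNetInput]
      rw [integral_sub h6 (integrable_const _)]
      simp [meanRate]
    rw [h5] at h2
    linarith
  · filter_upwards [h1, hreg] with ω hω hω'
    rw [hmem0 ω hω'] at hω
    push Not at hω
    exact hω

theorem ae_hasLongTermRate (hreg : ∀ᵐ ω ∂P, IsTraffic C (R ω) ∧ IsRightContinuous (R ω))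
    (hstat : IsStationary P fun (t : ℝ≥0) ω => R ω t)
    (herg : IsErgodic P fun (t : ℝ≥0) ω => R ω t) :
    ∀ᵐ ω ∂P, HasLongTermRate (R ω) (meanRate P R) := by
  have hup : ∀ᵐ ω ∂P, ∀ m : ℕ, ∃ B : ℕ, ∀ n : ℕ,
      1 * netInput (meanRate P R + 1 / ((m : ℝ) + 1)) (R ω) 0 n ≤ B := by
    refine ae_all_iff.2 fun m => ae_bounded_of_drift hreg hstat herg ?_
    have : (0 : ℝ) < 1 / ((m : ℝ) + 1) := by positivity
    linarith
  have hlow : ∀ᵐ ω ∂P, ∀ m : ℕ, ∃ B : ℕ, ∀ n : ℕ,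
      (-1) * netInput (meanRate P R - 1 / ((m : ℝ) + 1)) (R ω) 0 n ≤ B := by
    refine ae_all_iff.2 fun m => ae_bounded_of_drift hreg hstat herg ?_
    have : (0 : ℝ) < 1 / ((m : ℝ) + 1) := by positivity
    linarith
  filter_upwards [hreg, hup, hlow] with ω hω h1 h2
  refine hasLongTermRate_of_bounds hω.1 fun ε hε => ?_
  obtain ⟨m, hm⟩ := exists_nat_one_div_lt hε
  obtain ⟨B₁, hB₁⟩ := h1 m
  obtain ⟨B₂, hB₂⟩ := h2 m
  refine ⟨B₁ + B₂, fun n => ?_⟩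
  have h3 := hB₁ n
  have h4 := hB₂ n
  have h5 : 1 / ((m : ℝ) + 1) * n ≤ ε * n := mul_le_mul_of_nonneg_right hm.le (Nat.cast_nonneg n)
  have h6 : (0 : ℝ) ≤ B₁ := Nat.cast_nonneg _
  have h7 : (0 : ℝ) ≤ B₂ := Nat.cast_nonneg _
  unfold netInput at h3 h4
  rw [abs_le]
  constructor <;> linarith

theorem birkhoffSum_indicator_eq_card {α : Type*} (T : α → α) (Φ : Set α)
    [DecidablePred fun x => x ∈ Φ] (N : ℕ) (x : α) :
    birkhoffSum T (Φ.indicator fun _ => (1 : ℝ)) N x =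
      ((Finset.range N).filter fun k => T^[k] x ∈ Φ).card := by
  simp [birkhoffSum, indicator_apply]

/-- At a rate `ρ'` strictly between the mean rate and `ρ`, net inputs from a given time are almost
surely bounded; hence the paths exceeding `B` decrease to a null set. -/
theorem ae_rareLongExcursions_of_lt (hreg : ∀ᵐ ω ∂P, IsTraffic C (R ω) ∧ IsRightContinuous (R ω))
    (hstat : IsStationary P fun (t : ℝ≥0) ω => R ω t)
    (herg : IsErgodic P fun (t : ℝ≥0) ω => R ω t) (hρ : 0 < ρ) (hC : ρ < C)
    (hrate : meanRate P R < ρ) {c : ℝ} (hc : 0 < c) :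
    ∀ᵐ ω ∂P, RareLongExcursions (workload ρ (R ω)) c := by
  classical
  have hY := hstat.aemeasurable
  have : IsProbabilityMeasure (P.map fun ω (t : ℝ≥0) => R ω t) :=
    Measure.isProbabilityMeasure_map hY
  obtain ⟨ρ', h1, h2⟩ := exists_between (max_lt hrate hρ)
  rw [max_lt_iff] at h1
  set Φ : ℕ → Set (ℝ≥0 → ℝ) := fun B => {x | ∃ q : ℕ, (B : ℝ) < pathNetInput ρ' x q} with hΦ
  have hΦm : ∀ B, MeasurableSet (Φ B) := by
    intro B
    have : Φ B = ⋃ q : ℕ, {x | (B : ℝ) < pathNetInput ρ' x q} := by ext x; simp [hΦ]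
    rw [this]
    exact MeasurableSet.iUnion fun q =>
      measurableSet_lt measurable_const (measurable_pathNetInput ρ' q)
  have hanti : Antitone Φ := fun B B' hB x ⟨q, hq⟩ =>
    ⟨q, lt_of_le_of_lt (by exact_mod_cast hB) hq⟩
  have hnull : (P.map fun ω (t : ℝ≥0) => R ω t) (⋂ B, Φ B) = 0 := by
    refine measure_eq_zero_iff_ae_notMem.2 ((ae_map_iff hY
      (MeasurableSet.iInter hΦm).compl).2 ?_)
    filter_upwards [hreg, ae_bounded_of_drift hreg hstat herg (a := 1) (c := ρ') (by linarith)]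
      with ω hω ⟨B, hB⟩ hmem
    obtain ⟨q, hq⟩ := mem_iInter.1 hmem B
    rw [hω.1.pathNetInput_eq hω.2, NNReal.coe_natCast] at hq
    linarith [hB q]
  filter_upwards [hreg, ae_of_ae_map hY (ae_exists_birkhoffSum_indicator_le
    (hstat.measurePreserving_shift 1) hΦm hanti hnull)] with ω hω hfreq
  refine rareLongExcursions_of_drift hω.1 h1.2.le h2 hC hc fun l hl => ?_
  obtain ⟨B, hB⟩ := hfreq l hl
  refine ⟨B, fun N => ?_⟩
  have h3 := hB N
  rw [birkhoffSum_indicator_eq_card] at h3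
  convert h3 using 5 with k
  rw [iterate_shift, mul_one]
  refine exists_congr fun q => ?_
  have h4 := hω.1.pathNetInput_shift hω.2 ρ' k q
  simp only [NNReal.coe_natCast] at h4
  rw [h4]

theorem ae_rareLongExcursions_of_bddAbove
    (hreg : ∀ᵐ ω ∂P, IsTraffic C (R ω) ∧ IsRightContinuous (R ω))
    (hstat : IsStationary P fun (t : ℝ≥0) ω => R ω t) (hρ : 0 < ρ) (hC : ρ < C)
    (hbdd : ∀ᵐ ω ∂P, BddAbove (workload ρ (R ω) '' Ici 0)) {c : ℝ} (hc : 0 < c) :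
    ∀ᵐ ω ∂P, RareLongExcursions (workload ρ (R ω)) c := by
  classical
  have hY := hstat.aemeasurable
  have : IsProbabilityMeasure (P.map fun ω (t : ℝ≥0) => R ω t) :=
    Measure.isProbabilityMeasure_map hY
  have hC0 : 0 < C := hρ.trans hC
  obtain ⟨s, hs, hCs⟩ : ∃ s : ℝ≥0, 0 < s ∧ C * s ≤ c / 4 := by
    refine ⟨⟨c / 4 / C, by positivity⟩, ?_, ?_⟩
    · exact_mod_cast (show 0 < c / 4 / C by positivity)
    · change C * (c / 4 / C) ≤ c / 4
      rw [mul_div_cancel₀ _ hC0.ne']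
  set μ := P.map fun ω (t : ℝ≥0) => R ω t with hμ
  have hT := hstat.measurePreserving_shift s
  set F : ℕ → ℕ → (ℝ≥0 → ℝ) → ℝ := fun q r x => pathNetInput ρ (shift (q * s) x) (r * s) with hF
  have hFm : ∀ q r, Measurable (F q r) := fun q r =>
    (measurable_pathNetInput ρ _).comp (measurable_shift _)
  have hFT : ∀ q r x, F q r (shift s x) = F (q + 1) r x := by
    intro q r x
    simp only [hF, shift_shift]
    congr 2; push_cast; ring
  set E : ℝ → Set (ℝ≥0 → ℝ) := fun d => {x | ∀ q r, F q r x ≤ d} with hE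
  have hEm : ∀ d, MeasurableSet (E d) := by
    intro d
    have : E d = ⋂ q, ⋂ r, {x | F q r x ≤ d} := by ext x; simp [hE]
    rw [this]
    exact MeasurableSet.iInter fun q => MeasurableSet.iInter fun r =>
      measurableSet_le (hFm q r) measurable_const
  -- `E d` is contained in its preimage and has the same finite measure, so they agree almost
  -- everywhere: a path outside `E d` never enters it.
  have hEinv : ∀ d, ∀ᵐ x ∂μ, shift s x ∈ E d → x ∈ E d := by
    intro d
    have hsub : E d ⊆ shift s ⁻¹' E d := fun x hx q r => by rw [hFT]; exact hx _ _
    have h1 := ae_eq_of_subset_of_measure_ge hsub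
      (hT.measure_preimage (hEm d).nullMeasurableSet).le (hEm d).nullMeasurableSet
      (measure_ne_top μ _)
    filter_upwards [h1.mem_iff] with x hx using hx.2
  set Φ : ℝ → ℕ → Set (ℝ≥0 → ℝ) := fun d K => (E d)ᶜ ∩ {x | ∀ q ≤ K, ∀ r, F q r x ≤ d} with hΦ
  have hΦm : ∀ d K, MeasurableSet (Φ d K) := by
    intro d K
    have : {x | ∀ q ≤ K, ∀ r, F q r x ≤ d} = ⋂ q, ⋂ (_ : q ≤ K), ⋂ r, {x | F q r x ≤ d} := by
      ext x; simp
    refine (hEm d).compl.inter ?_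
    rw [this]
    exact MeasurableSet.iInter fun q => MeasurableSet.iInter fun _ => MeasurableSet.iInter fun r =>
      measurableSet_le (hFm q r) measurable_const
  have hanti : ∀ d, Antitone (Φ d) := fun d K K' hK x hx =>
    ⟨hx.1, fun q hq r => hx.2 q (hq.trans hK) r⟩
  have hnull : ∀ d, μ (⋂ K, Φ d K) = 0 := by
    intro d
    have : ⋂ K, Φ d K = ∅ := by
      refine eq_empty_of_forall_notMem fun x hx => ?_
      rw [mem_iInter] at hx
      exact (hx 0).1 fun q r => (hx q).2 q le_rfl r
    rw [this, measure_empty]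
  -- The level depends on the path; restricting it to rationals keeps the exceptional sets countable
  -- in number.
  have hfreq : ∀ᵐ x ∂μ, ∀ b : ℚ, ∀ l : ℝ, 0 < l → ∃ K, ∀ n,
      birkhoffSum (shift s) ((Φ (b - c / 2) K).indicator fun _ => (1 : ℝ)) n x ≤ l * n :=
    ae_all_iff.2 fun b => ae_exists_birkhoffSum_indicator_le hT (hΦm _) (hanti _) (hnull _)
  have hiter : ∀ᵐ x ∂μ, ∀ b : ℚ, ∀ k : ℕ, shift s ((shift s)^[k] x) ∈ E (b - c / 2) →
      (shift s)^[k] x ∈ E (b - c / 2) :=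
    ae_all_iff.2 fun b => ae_all_iff.2 fun k =>
      (hT.iterate k).quasiMeasurePreserving.ae (hEinv _)
  filter_upwards [hreg, hbdd, ae_of_ae_map hY hfreq, ae_of_ae_map hY hiter] with ω hω hb hfr hit
  have hFω : ∀ q r, F q r (fun t : ℝ≥0 => R ω t) = netInput ρ (R ω) (s * q) (s * (q + r)) := by
    intro q r
    simp only [hF]
    rw [hω.1.pathNetInput_shift hω.2]
    congr 1 <;> push_cast <;> ring
  obtain ⟨B, hB⟩ := hb
  have hle : ∀ q r : ℕ, netInput ρ (R ω) (s * q) (s * (q + r)) ≤ B := by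
    intro q r
    have h0 : (0 : ℝ) ≤ s * q := by positivity
    have h1 : (s : ℝ) * q ≤ s * (q + r) := by
      have : (0 : ℝ) ≤ s * r := by positivity
      linarith
    exact (hω.1.le_workload h0 h1).trans (hB (mem_image_of_mem _ (h0.trans h1)))
  set V : Set ℝ := range fun qr : ℕ × ℕ => netInput ρ (R ω) (s * qr.1) (s * (qr.1 + qr.2)) with hV
  have hVb : BddAbove V := ⟨B, by rintro _ ⟨qr, rfl⟩; exact hle _ _⟩
  have hVn : V.Nonempty := range_nonempty _
  -- This `b` bounds all grid net inputs, while `b - c / 2` is exceeded by one of them; so the path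
  -- starts outside the invariant set and stays there.
  obtain ⟨b, hb1, hb2⟩ := exists_rat_btwn (lt_add_of_pos_right (sSup V) (half_pos hc))
  obtain ⟨_, ⟨⟨q₀, r₀⟩, rfl⟩, hqr⟩ := exists_lt_of_lt_csSup hVn (by linarith : (b : ℝ) - c / 2 < _)
  have hnot : ∀ k : ℕ, (shift s)^[k] (fun t : ℝ≥0 => R ω t) ∉ E (b - c / 2) := by
    intro k
    induction k with
    | zero =>
      intro hmem
      have h1 := hmem q₀ r₀
      rw [Function.iterate_zero, id, hFω] at h1
      exact absurd hqr (not_lt.2 h1)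
    | succ k ih =>
      rw [Function.iterate_succ_apply']
      exact fun hmem => ih (hit b k hmem)
  refine rareLongExcursions_of_bounded hω.1 hρ.le hc (NNReal.coe_pos.2 hs) hCs (b := b)
    (fun q r => (le_csSup hVb ⟨(q, r), rfl⟩).trans hb1.le) fun l hl => ?_
  obtain ⟨K, hK⟩ := hfr b l hl
  refine ⟨K, fun N => ?_⟩
  have h3 := hK N
  rw [birkhoffSum_indicator_eq_card] at h3
  refine le_trans (Nat.cast_le.2 (Finset.card_le_card fun k hk => ?_)) h3
  rw [Finset.mem_filter] at hk ⊢
  refine ⟨hk.1, hnot k, fun q hq r => ?_⟩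
  have h4 : F q r ((shift s)^[k] fun t : ℝ≥0 => R ω t) = F (k + q) r fun t : ℝ≥0 => R ω t := by
    simp only [hF, iterate_shift, shift_shift]
    congr 2; push_cast; ring
  rw [h4, hFω]
  have := hk.2 q hq r
  push_cast
  exact this

/-- Long excursions of the workload of stationary and ergodic traffic are rare. -/
theorem ae_rareLongExcursions (hreg : ∀ᵐ ω ∂P, IsTraffic C (R ω) ∧ IsRightContinuous (R ω))
    (hstat : IsStationary P fun (t : ℝ≥0) ω => R ω t)
    (herg : IsErgodic P fun (t : ℝ≥0) ω => R ω t) (hρ : 0 < ρ) (hC : ρ < C)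
    (hrate : ∀ᵐ ω ∂P, ∀ r, HasLongTermRate (R ω) r → r ≤ ρ)
    (hcrit : ∀ᵐ ω ∂P, HasLongTermRate (R ω) ρ → BddAbove (workload ρ (R ω) '' Ici 0))
    {c : ℝ} (hc : 0 < c) : ∀ᵐ ω ∂P, RareLongExcursions (workload ρ (R ω)) c := by
  have h1 := ae_hasLongTermRate hreg hstat herg
  -- The mean rate is deterministic, so one path suffices to compare it with `ρ`.
  obtain ⟨ω, hω, hω'⟩ := (hrate.and h1).exists
  rcases (hω _ hω').lt_or_eq with hlt | heq
  · exact ae_rareLongExcursions_of_lt hreg hstat herg hρ hC hlt hc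
  · rw [heq] at h1
    refine ae_rareLongExcursions_of_bddAbove hreg hstat hρ hC ?_ hc
    filter_upwards [h1, hcrit] with ω h2 h3 using h3 h2

end Stationary

/-! ### Assembly of the theorem -/

/-- The only explicit value of `f̄` that matters, shared by both variants; at the other tested
thresholds, domination by `f` suffices. -/
theorem piecewiseBound_last {f : ℝ → ℝ} {M : ℕ} {T : ℕ → ℝ} {Tlim : ℝ} {a : ℕ → ℝ}
    (h1 : T 1 ≤ T M) (h2 : T (M - 1) ≤ T M) : piecewiseBound f M T Tlim a (T M) = f Tlim := by
  unfold piecewiseBound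
  rw [if_neg (not_lt.2 h1), if_neg (not_lt.2 h2), if_pos le_rfl]

end StochReg

theorem theorem1 {Ω : Type*} [MeasurableSpace Ω] (P : Measure Ω) [IsProbabilityMeasure P]
    (p : StochReg.Params) (f : ℝ → ℝ) (Tlim : ℝ)
    -- link capacity and rate
    (hρ : 0 < p.ρ) (hC : p.ρ < p.C)
    -- thresholds
    (hM : 2 ≤ p.M)
    (hT1 : p.δ ≤ p.T 1)
    (hT : ∀ i, 1 ≤ i → i + 1 ≤ p.M → p.δ ≤ p.T (i + 1) - p.T i)
    (hTlim : p.δ ≤ Tlim - p.T (p.M - 1))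
    (hTM : Tlim < p.T p.M)
    -- bounding function and its piecewise-linear approximation
    (hf0 : f 0 = 1)
    (hfpos : ∀ γ ∈ Icc 0 Tlim, 0 < f γ)
    (hfanti : AntitoneOn f (Icc 0 Tlim))
    (hfstrict : ∀ i, 1 ≤ i → i + 2 ≤ p.M → ∃ γ ∈ Ioo (p.T i) (p.T (i + 1)), f (p.T (i + 1)) < f γ)
    (hfstrict' : ∃ γ ∈ Ioo (p.T (p.M - 1)) Tlim, f Tlim < f γ)
    (hbound : p.bound = StochReg.fbar f p.M p.T Tlim ∨
      p.bound = StochReg.fbarModified f p.M p.T Tlim p.δ)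
    (hlower : ∀ γ ∈ Icc (p.T 1) Tlim, p.bound γ ≤ f γ)
    -- input packets: arrival times and lengths
    (s L : ℕ → Ω → ℝ) (hs : ∀ j, Measurable (s j)) (hL : ∀ j, Measurable (L j))
    (hs0 : ∀ᵐ ω ∂P, 0 ≤ s 0 ω)
    (hLen : ∀ᵐ ω ∂P, ∀ j, 0 < L j ω ∧ L j ω ≤ p.Lmax)
    (hsep : ∀ᵐ ω ∂P, ∀ j, s j ω + L j ω / p.C < s (j + 1) ω)
    (hslim : ∀ᵐ ω ∂P, Tendsto (fun j => s j ω) atTop atTop)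
    -- the input traffic is stationary and ergodic
    (hstat : StochReg.IsStationary P
      (fun t ω => StochReg.inputStream p (fun j => s j ω) (fun j => L j ω) (t : ℝ)))
    (herg : StochReg.IsErgodic P
      (fun t ω => StochReg.inputStream p (fun j => s j ω) (fun j => L j ω) (t : ℝ)))
    -- `ρ` is at least the long-term average rate of the input; in case of equality, the workload
    -- of the input does not grow without bound
    (hrate : ∀ᵐ ω ∂P, ∀ r,
      StochReg.HasLongTermRate
        (StochReg.inputStream p (fun j => s j ω) (fun j => L j ω)) r → r ≤ p.ρ)
    (hcrit : ∀ᵐ ω ∂P,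
      StochReg.HasLongTermRate
        (StochReg.inputStream p (fun j => s j ω) (fun j => L j ω)) p.ρ →
      BddAbove (StochReg.workload p.ρ
        (StochReg.inputStream p (fun j => s j ω) (fun j => L j ω)) '' Ici 0))
    -- `T_M` is so large that `𝓑_j` is non-empty for every packet
    (hB : ∀ᵐ ω ∂P, ∀ j,
      (StochReg.setB p (fun j => s j ω) (fun j => L j ω)
        (StochReg.departure p (fun j => s j ω) (fun j => L j ω)) j).Nonempty) :
    ∀ᵐ ω ∂P, ∀ᶠ t in atTop, ∀ γ ∈ Icc (p.T 1) Tlim,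
      StochReg.overshootRatio p.ρ
        (StochReg.outputStream p (fun j => s j ω) (fun j => L j ω)) γ t ≤ f γ := by
  have hC0 : 0 < p.C := hρ.trans hC
  have hreg : ∀ᵐ ω ∂P,
      StochReg.IsTraffic p.C (StochReg.inputStream p (fun j => s j ω) (fun j => L j ω)) ∧
      StochReg.IsRightContinuous (StochReg.inputStream p (fun j => s j ω) (fun j => L j ω)) := by
    filter_upwards [hs0, hLen, hsep, hslim] with ω h0 hl hse hsl
    have hsch : StochReg.IsSchedule p.C (fun j => L j ω) (fun j => s j ω) :=
      ⟨h0, fun j => div_pos (hl j).1 hC0, fun j => (hse j).le⟩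
    exact ⟨StochReg.isTraffic_packetStream hC0.le _ _ _, hsch.isRightContinuous hsl⟩
  -- Needed for `T 1 > 0`, the level of the rare excursions; the existence of a packet of positive
  -- length on some path gives `L_max > 0`.
  have hδ : 0 < p.δ := by
    obtain ⟨ω, hl⟩ := hLen.exists
    exact mul_pos (sub_pos.2 ((div_lt_one hC0).2 hC)) ((hl 0).1.trans_le (hl 0).2)
  filter_upwards [hs0, hLen, hsep, hslim, hB, StochReg.ae_rareLongExcursions hreg hstat herg hρ hC
    hrate hcrit (hδ.trans_le hT1)] with ω h0 hl hse hsl hBω hrare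
  have hadm : StochReg.Admissible p (fun j => s j ω) (fun j => L j ω) :=
    ⟨hρ, hC, hM, hT1, hT, h0, hl, hse, hsl, hBω⟩
  refine hadm.eventually_overshootRatio_le hrare hTlim hfanti hfpos hfstrict hfstrict' hlower ?_
  have h1 := hadm.T_mono le_rfl (by omega : 1 ≤ p.M) le_rfl
  have h2 : p.T (p.M - 1) ≤ p.T p.M := by linarith
  rcases hbound with hb | hb <;> rw [hb]
  · exact (StochReg.piecewiseBound_last h1 h2).le
  · exact (StochReg.piecewiseBound_last h1 h2).le
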